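/- Let $n\ge 4$, let $q$ be a prime power, and let $Q$ be a hyperbolic quadratic form on $V=\mathbb F_q^{2n}$ (nondegenerate, with totally singular subspaces of dimension $n$, called generators). The generators fall into two classes, two generators $N_1,N_2$ being in the same class if and only if $\dim(N_1\cap N_2)\equiv n \pmod 2$. The oriflamme complex of the hyperbolic quadric $Q=0$ has the types $1,\dots,n-2,n,n'$: its elements of type $i\le n-2$ are the totally singular subspaces of (vector space) dimension $i$, and its elements of type $n$ and $n'$ are the generators of the first and of the second class. Incidence is symmetrized inclusion, except that generators of types $n$ and $n'$ are incident if they meet in dimension $n-1$. A flag is a set of pairwise incident elements; its type $J$ is the set of the types of its elements. Let $G$ be the group of type-preserving isometries of $Q$, acting on the maximal flags, with its $BN$-pair: $B$ is the stabilizer of the maximal flag $\langle e_1\rangle,\dots,\langle e_1,\dots,e_{n-2}\rangle,\langle e_1,\dots,e_{n-1},e_n\rangle,\langle e_1,\dots,e_{n-1},e_{-n}\rangle$ of a polar frame $\{e_{\pm1},\dots,e_{\pm n}\}$ (singular points, $e_i$ being orthogonal to all of them except $e_{-i}$), and the Weyl group $W$ of type $D_n$ acts on the indices of the frame by the permutations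 generated by $s_i=(i,i+1)(-i,-(i+1))$, $1\le i\le n-1$, and $u=ts_{n-1}t$, where $t=(-n,n)$. The generators $s_1,\dots,s_{n-2},u,s_{n-1}$ correspond to the types $1,\dots,n-2,n,n'$. Let $w_0$ be the longest element of $W$; it acts on the types by conjugation of these generators. Two maximal flags $gB,hB$ are opposite if $Bg^{-1}hB=Bw_0B$; two flags of types $J$ and $K$ are opposite if $J^{w_0}=K$ and they can be extended to opposite maximal flags. For a type $J$ with $J^{w_0}=J$, an EKR-set of flags of type $J$ is a set of flags of type $J$ no two of which are opposite. Theorem. Let $J=J^{w_0}$ and let $C$ be one of the following sets of flags of type $J$: (i) if $1\in J$: all flags of type $J$ whose element of type $1$ (the point) lies in a fixed generator (of either class); (ii) if $n$ is even and $n\in J$ (resp. $n'\in J$): all flags of type $J$ whose element of type $n$ (resp. $n'$) passes through a fixed point of the quadric; (iii) if $n=4$ and $n\in J$ (resp. $n'\in J$): all flags of type $J$ whose element of type $n$ (resp. $n'$) is incident with a fixed element of type $n'$ (resp. $n$). Then $C$ is an EKR-set of flags, and $$|C|=\frac{v}{1+q^{n-1}},$$ where $v$ is the number of all flags of type $J$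 (this is the general upper bound for the size of an EKR-set of flags of type $J$). -/

import Mathlib

namespace Oriflamme

open Module

/-- The types of elements of the oriflamme complex of a hyperbolic quadric of rank `n`, i.e. the
nodes of the Dynkin diagram `D_n`: `sub i` is the type `i + 1` in `{1, …, n - 2}`, `gen` is the
type `n` and `gen'` is the type `n'`. -/
inductive Node (n : ℕ) : Type
  | sub (i : Fin (n - 2)) : Node n
  | gen : Node n
  | gen' : Node n

/-! ### The Weyl group of type `D_n`

The set `{-n, …, -1, 1, …, n}` is `Fin n × ℤˣ`; the pair `(i, ε)` stands for `ε (i + 1)`. -/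

/-- The involution `s_{k+1} = (k+1, k+2)(-(k+1), -(k+2))`, for `k + 1 < n`. -/
def sGen (n k : ℕ) : Equiv.Perm (Fin n × ℤˣ) :=
  if h : k + 1 < n then
    Equiv.prodCongr (Equiv.swap ⟨k, by omega⟩ ⟨k + 1, h⟩) (Equiv.refl ℤˣ)
  else 1

/-- The transposition `t = (-n, n)`. -/
def tGen (n : ℕ) : Equiv.Perm (Fin n × ℤˣ) :=
  if h : 0 < n then Equiv.swap (⟨n - 1, by omega⟩, 1) (⟨n - 1, by omega⟩, -1) else 1

/-- The Coxeter generator attached to a node: `s_1, …, s_{n-2}` for the types `1, …, n - 2`,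
`u = t s_{n-1} t` for the type `n`, and `s_{n-1}` for the type `n'`. In the standard maximal flag
(see `frameSpace`) the generator of a node moves the element of that type and no other one. -/
def simpleReflection {n : ℕ} : Node n → Equiv.Perm (Fin n × ℤˣ)
  | .sub i => sGen n i
  | .gen => tGen n * sGen n (n - 2) * tGen n
  | .gen' => sGen n (n - 2)

/-- The Weyl group of type `D_n`. -/
def weylGroup (n : ℕ) : Subgroup (Equiv.Perm (Fin n × ℤˣ)) :=
  Subgroup.closure (Set.range (simpleReflection (n := n)))

/-- The length of an element of the Weyl group: the least length of a word in the generators. -/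
noncomputable def length {n : ℕ} (w : Equiv.Perm (Fin n × ℤˣ)) : ℕ :=
  sInf {k : ℕ | ∃ l : List (Node n), l.length = k ∧ (l.map simpleReflection).prod = w}

/-- `w` is the longest element of the Weyl group. -/
def IsLongest {n : ℕ} (w : Equiv.Perm (Fin n × ℤˣ)) : Prop :=
  w ∈ weylGroup n ∧ ∀ v ∈ weylGroup n, length v ≤ length w

/-- `K = J ^ w`: conjugation by `w` maps the generators of the nodes in `J` onto those of the
nodes in `K`. -/
def ConjType {n : ℕ} (w : Equiv.Perm (Fin n × ℤˣ)) (J K : Set (Node n)) : Prop :=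
  (fun s => w⁻¹ * s * w) '' (simpleReflection '' J) = simpleReflection '' K

/-! ### The hyperbolic quadric and its oriflamme complex -/

variable {F V : Type*} [Field F] [AddCommGroup V] [Module F V]

/-- Totally singular subspaces, i.e. the subspaces contained in the quadric `Q = 0`. -/
def TotallySingular (Q : QuadraticForm F V) (U : Submodule F V) : Prop :=
  ∀ x ∈ U, Q x = 0

/-- `Q` defines a hyperbolic quadric of rank `n`: it is a nondegenerate quadratic form in
dimension `2n` with a totally singular subspace of dimension `n`. -/
def IsHyperbolic (n : ℕ) (Q : QuadraticForm F V) : Prop :=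
  finrank F V = 2 * n ∧ (QuadraticMap.polarBilin Q).SeparatingLeft ∧
    ∃ M : Submodule F V, TotallySingular Q M ∧ finrank F M = n

/-- The points of the quadric. -/
def IsPoint (Q : QuadraticForm F V) (P : Submodule F V) : Prop :=
  TotallySingular Q P ∧ finrank F P = 1

/-- The generators of the quadric of rank `n`. -/
def IsGenerator (n : ℕ) (Q : QuadraticForm F V) (M : Submodule F V) : Prop :=
  TotallySingular Q M ∧ finrank F M = n

/-- Polar frames `e_{-n}, …, e_{-1}, e_1, …, e_n`, given by vectors spanning the points: singular
points such that `e_i` is collinear (orthogonal) to all of them except `e_{-i}`. The vectors are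
nonzero, since `e_i` is not orthogonal to `e_{-i}`. -/
def IsPolarFrame {n : ℕ} (Q : QuadraticForm F V) (e : Fin n × ℤˣ → V) : Prop :=
  (∀ a, Q (e a) = 0) ∧
    ∀ a b, QuadraticMap.polar Q (e a) (e b) = 0 ↔ b ≠ (a.1, -a.2)

/-- The members of the maximal flag `⟨e_1⟩, ⟨e_1, e_2⟩, …, ⟨e_1, …, e_{n-2}⟩` together with
`⟨e_1, …, e_{n-1}, e_n⟩` (type `n`) and `⟨e_1, …, e_{n-1}, e_{-n}⟩` (type `n'`). -/
def frameSpace {n : ℕ} (e : Fin n × ℤˣ → V) : Node n → Submodule F V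
  | .sub i => Submodule.span F (e '' {a | a.1.val ≤ i.val ∧ a.2 = 1})
  | .gen => Submodule.span F (e '' {a | a.2 = 1})
  | .gen' => Submodule.span F (e '' {a | a.2 = if a.1.val + 1 = n then -1 else 1})

/-- `U` is an element of type `j`. The class of generators called type `n` is the one that contains
`⟨e_1, …, e_n⟩`; two generators are in the same class when the dimension of their intersection is
congruent to `n` modulo `2`. -/
def HasType {n : ℕ} (Q : QuadraticForm F V) (e : Fin n × ℤˣ → V) :
    Node n → Submodule F V → Prop
  | .sub i, U => TotallySingular Q U ∧ finrank F U = i.val + 1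
  | .gen, U => IsGenerator n Q U ∧
      finrank F (U ⊓ frameSpace e .gen : Submodule F V) ≡ n [MOD 2]
  | .gen', U => IsGenerator n Q U ∧
      ¬ finrank F (U ⊓ frameSpace e .gen : Submodule F V) ≡ n [MOD 2]

/-- Incidence of an element `U` of type `j` and an element `W` of type `k`: symmetrized inclusion,
and elements of types `n` and `n'` are incident when they meet in dimension `n - 1`. -/
def Incident {n : ℕ} (j k : Node n) (U W : Submodule F V) : Prop :=
  U ≤ W ∨ W ≤ U ∨
    (((j = .gen ∧ k = .gen') ∨ (j = .gen' ∧ k = .gen)) ∧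
      finrank F (U ⊓ W : Submodule F V) + 1 = n)

/-- The flags of type `J`: one element of each type in `J`, any two of them incident (distinct
elements of one type are never incident). -/
@[ext]
structure Flag {n : ℕ} (Q : QuadraticForm F V) (e : Fin n × ℤˣ → V) (J : Set (Node n)) where
  elt : (j : Node n) → j ∈ J → Submodule F V
  hasType : ∀ j hj, HasType Q e j (elt j hj)
  incident : ∀ j hj k hk, Incident j k (elt j hj) (elt k hk)

/-- The group acting on the oriflamme complex: the linear isometries of `Q` that preserve types
(up to scalars). -/
def isometryGroup {n : ℕ} (Q : QuadraticForm F V) (e : Fin n × ℤˣ → V) :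
    Subgroup (V ≃ₗ[F] V) where
  carrier := {g | (∀ x, Q (g x) = Q x) ∧
    ∀ (j : Node n) (U : Submodule F V),
      HasType Q e j (U.map (g : V →ₗ[F] V)) ↔ HasType Q e j U}
  one_mem' := by
    refine ⟨fun x => rfl, fun j U => ?_⟩
    have : U.map ((1 : V ≃ₗ[F] V) : V →ₗ[F] V) = U := Submodule.map_id U
    rw [this]
  mul_mem' := by
    rintro g h ⟨hg, hg'⟩ ⟨hh, hh'⟩
    refine ⟨fun x => (hg (h x)).trans (hh x), fun j U => ?_⟩
    have : U.map ((g * h : V ≃ₗ[F] V) : V →ₗ[F] V)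
        = (U.map (h : V →ₗ[F] V)).map (g : V →ₗ[F] V) :=
      Submodule.map_comp (h : V →ₗ[F] V) (g : V →ₗ[F] V) U
    rw [this, hg', hh']
  inv_mem' := by
    rintro g ⟨hg, hg'⟩
    refine ⟨fun x => ?_, fun j U => ?_⟩
    · rw [← hg (g⁻¹ x)]
      exact congrArg Q (g.apply_symm_apply x)
    · rw [← hg' j]
      have : (U.map ((g⁻¹ : V ≃ₗ[F] V) : V →ₗ[F] V)).map (g : V →ₗ[F] V) = U := by
        rw [← Submodule.map_comp]
        convert Submodule.map_id U
        ext x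
        exact g.apply_symm_apply x
      rw [this]

/-- The relation `R_w` on maximal flags, `{(gB, gwB) : g ∈ G}`, where the coset `gB` is the image
under `g` of the standard flag of the frame `e`, and `wB` is the flag of the frame `i ↦ e_{w(i)}`. -/
def relPos {n : ℕ} (Q : QuadraticForm F V) (e : Fin n × ℤˣ → V) (w : Equiv.Perm (Fin n × ℤˣ))
    (x y : Flag Q e Set.univ) : Prop :=
  ∃ g ∈ isometryGroup Q e,
    (∀ j hj, x.elt j hj = (frameSpace e j).map (g : V →ₗ[F] V)) ∧
    (∀ j hj, y.elt j hj = (frameSpace (e ∘ w) j).map (g : V →ₗ[F] V))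

/-- The maximal flag `c` extends the flag `x`. -/
def Extends {n : ℕ} {Q : QuadraticForm F V} {e : Fin n × ℤˣ → V} {J : Set (Node n)}
    (c : Flag Q e Set.univ) (x : Flag Q e J) : Prop :=
  ∀ j hj, c.elt j (Set.mem_univ j) = x.elt j hj

/-- Opposite flags of types `J` and `K`, for the longest element `w₀`. -/
def Opposite {n : ℕ} {Q : QuadraticForm F V} {e : Fin n × ℤˣ → V}
    (w₀ : Equiv.Perm (Fin n × ℤˣ)) {J K : Set (Node n)}
    (x : Flag Q e J) (y : Flag Q e K) : Prop :=
  ConjType w₀ J K ∧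
    ∃ c d : Flag Q e Set.univ, Extends c x ∧ Extends d y ∧ relPos Q e w₀ c d

/-- EKR-sets of flags: no two flags in `C` are opposite. -/
def IsEKR {n : ℕ} {Q : QuadraticForm F V} {e : Fin n × ℤˣ → V}
    (w₀ : Equiv.Perm (Fin n × ℤˣ)) {J : Set (Node n)} (C : Set (Flag Q e J)) : Prop :=
  ∀ x ∈ C, ∀ y ∈ C, ¬ Opposite w₀ x y

/-- `|C| = v / (1 + q^{n-1})`, where `v` is the number of all flags of type `J`. -/
def MeetsBound {n : ℕ} {Q : QuadraticForm F V} {e : Fin n × ℤˣ → V} {J : Set (Node n)}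
    (C : Set (Flag Q e J)) : Prop :=
  (C.ncard : ℚ) = (Nat.card (Flag Q e J) : ℚ) / (1 + (Nat.card F : ℚ) ^ (n - 1))

/-- The type `1`. -/
def pointNode (n : ℕ) (hn : 4 ≤ n) : Node n := .sub ⟨0, by omega⟩

end Oriflamme

/-! Everything is read off from how the element x_j of type j of a flag x meets a fixed totally
singular subspace M (a generator, or a point in case (ii)).

Size. Type-preserving isometries are transitive on nonzero singular vectors, so each such vector
lies in x_j for the same number c of flags x. Count pairs (p, x) with p in x_j, once for all
singular p and once for p in M only, and eliminate c: this gives the sum over x of q^dim(x_j ∩ M) -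
1 (`sum_flag_finrank_inf`). There are (q^n - 1)(1 + q^(n-1)) nonzero singular vectors, whence the
denominator of the bound. The dimension of x_j ∩ M takes one value on C and another off C (1 and 0
in (i) and (ii), 3 and 1 in (iii)), so the sum becomes a linear equation for |C|
(`meetsBound_of_finrank_inf`).

Parity. For any three generators, n plus the dimensions of the three pairwise intersections is even
(`even_finrank_inf_add`). Hence a reflection swaps the two classes, a product of two reflections
preserves types, and such products give the transitivity. The same law yields the values 3 and 1 in
case (iii).

No opposite pairs. The longest element makes every simple root negative; this forces i ↦ -i for i <
n, and also for i = n when n is even. So opposite points are not orthogonal and, for n even,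
opposite generators are disjoint. But two points of a generator are orthogonal, two generators
through P are not disjoint, and two 3-spaces in a 4-space intersect. -/

namespace Oriflamme

open Module

/-! ### Alternating forms -/

section Alternating

variable {F : Type*} [Field F]

/-- The rank of an alternating bilinear form is even. -/
theorem even_finrank_add_finrank_ker_of_isAlt {W : Type*} [AddCommGroup W] [Module F W]
    [FiniteDimensional F W] (B : LinearMap.BilinForm F W) (hB : B.IsAlt) :
    Even (finrank F W + finrank F (LinearMap.ker B)) := by
  induction hd : finrank F W using Nat.strong_induction_on generalizing W with
  | _ d ih =>
  subst hd
  by_cases h0 : B = 0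
  · subst h0
    rw [LinearMap.ker_zero, finrank_top]
    exact ⟨_, rfl⟩
  obtain ⟨u, v', huv'⟩ : ∃ u v, B u v ≠ 0 := by
    by_contra! h
    exact h0 (LinearMap.ext fun u => LinearMap.ext fun v => h u v)
  obtain ⟨v, huv⟩ : ∃ v, B u v = 1 := ⟨(B u v')⁻¹ • v', by simp [huv']⟩
  have hvu : B v u = -1 := by rw [← hB.neg_eq, huv]
  have huu : B u u = 0 := hB.self_eq_zero u
  have hvv : B v v = 0 := hB.self_eq_zero v
  -- Split off the hyperbolic plane ⟨u, v⟩: the kernel of `L` is its orthogonal complement, of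
  -- codimension 2 and with the same radical as `B`.
  let L : W →ₗ[F] F × F := (B u).prod (B v)
  have hLsurj : LinearMap.range L = ⊤ := by
    rw [LinearMap.range_eq_top]
    rintro ⟨a, b⟩
    refine ⟨a • v - b • u, ?_⟩
    simp [L, huv, hvu, huu, hvv]
  have hfin : finrank F (LinearMap.ker L) + 2 = finrank F W := by
    rw [← LinearMap.finrank_range_add_finrank_ker L, hLsurj, finrank_top]
    simp [add_comm]
  have hlt : finrank F (LinearMap.ker L) < finrank F W := by omega
  have key := ih _ hlt (B.restrict (LinearMap.ker L)) (fun x => hB x) rfl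
  have hker : (LinearMap.ker (B.restrict (LinearMap.ker L))).map (LinearMap.ker L).subtype
      = LinearMap.ker B := by
    ext x
    constructor
    · rintro ⟨y, hy, rfl⟩
      have hyu : B u y = 0 := congrArg Prod.fst (LinearMap.mem_ker.1 y.2)
      have hyv : B v y = 0 := congrArg Prod.snd (LinearMap.mem_ker.1 y.2)
      refine LinearMap.mem_ker.2 (LinearMap.ext fun z => ?_)
      let z' : W := z - (B u z) • v + (B v z) • u
      have hz' : z' ∈ LinearMap.ker L := by
        rw [LinearMap.mem_ker]
        simp [L, z', huv, hvu, huu, hvv]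
      have h1 : B y z' = 0 := LinearMap.congr_fun (LinearMap.mem_ker.1 hy) ⟨z', hz'⟩
      have h2 : B y u = 0 := by rw [← hB.neg_eq, hyu, neg_zero]
      have h3 : B y v = 0 := by rw [← hB.neg_eq, hyv, neg_zero]
      simpa [z', h2, h3] using h1
    · intro hx
      have hx' : ∀ z, B x z = 0 := fun z => LinearMap.congr_fun (LinearMap.mem_ker.1 hx) z
      have hxL : x ∈ LinearMap.ker L := by
        rw [LinearMap.mem_ker]
        refine Prod.ext ?_ ?_
        · change B u x = 0
          rw [← hB.neg_eq, hx', neg_zero]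
        · change B v x = 0
          rw [← hB.neg_eq, hx', neg_zero]
      exact ⟨⟨x, hxL⟩, LinearMap.mem_ker.2 (LinearMap.ext fun z => hx' z), rfl⟩
  rw [← hker, Submodule.finrank_map_subtype_eq, ← hfin]
  rw [Nat.even_iff] at key ⊢
  omega

end Alternating

/-! ### Orthogonality and the parity law for generators -/

section Perp

variable {F V : Type*} [Field F] [AddCommGroup V] [Module F V] {Q : QuadraticForm F V} {n : ℕ}

open QuadraticMap

theorem isRefl_polarBilin (Q : QuadraticForm F V) : (polarBilin Q).IsRefl := fun x y h => by
  rw [polarBilin_apply_apply] at h ⊢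
  rw [polar_comm, h]

theorem polar_eq_zero_of_totallySingular {M : Submodule F V} (hM : TotallySingular Q M) {x y : V}
    (hx : x ∈ M) (hy : y ∈ M) : polar Q x y = 0 := by
  rw [polar, hM _ hx, hM _ hy, hM _ (M.add_mem hx hy)]
  simp

theorem IsHyperbolic.nondegenerate (hQ : IsHyperbolic n Q) : (polarBilin Q).Nondegenerate :=
  ⟨hQ.2.1, fun y hy => hQ.2.1 y fun x => by
    have := hy x
    rw [polarBilin_apply_apply] at this ⊢
    rw [polar_comm, this]⟩

theorem IsHyperbolic.finiteDimensional (hn : 0 < n) (hQ : IsHyperbolic n Q) :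
    FiniteDimensional F V :=
  FiniteDimensional.of_finrank_pos (by rw [hQ.1]; omega)

/-- The orthogonal space with respect to the polar form. -/
abbrev perp (Q : QuadraticForm F V) (U : Submodule F V) : Submodule F V :=
  LinearMap.BilinForm.orthogonal (polarBilin Q) U

/-- The sum map `A × B × C → V`. -/
def sumMap (A B C : Submodule F V) : (A × B × C) →ₗ[F] V :=
  A.subtype.coprod (B.subtype.coprod C.subtype)

theorem range_sumMap (A B C : Submodule F V) :
    LinearMap.range (sumMap A B C) = A ⊔ (B ⊔ C) := by
  simp [sumMap, LinearMap.range_coprod]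

/-- The map `(x, y, z) ↦ (x + y, -x + z, -y - z)` parametrizing the radical. -/
def radMap (A B C : Submodule F V) :
    ((A ⊓ B : Submodule F V) × (A ⊓ C : Submodule F V) × (B ⊓ C : Submodule F V)) →ₗ[F]
      A × B × C where
  toFun p := (⟨p.1 + p.2.1, A.add_mem p.1.2.1 p.2.1.2.1⟩,
    ⟨-p.1 + p.2.2, B.add_mem (B.neg_mem p.1.2.2) p.2.2.2.1⟩,
    ⟨-p.2.1 - p.2.2, C.sub_mem (C.neg_mem p.2.1.2.2) p.2.2.2.2⟩)
  map_add' p r := by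
    refine Prod.ext (Subtype.ext ?_) (Prod.ext (Subtype.ext ?_) (Subtype.ext ?_)) <;>
    · simp
      abel
  map_smul' c p := by
    refine Prod.ext (Subtype.ext ?_) (Prod.ext (Subtype.ext ?_) (Subtype.ext ?_)) <;>
    simp [smul_sub]

/-- The kernel consists of the triples (x, -x, x) with x in all three subspaces. -/
theorem finrank_ker_radMap (A B C : Submodule F V) :
    finrank F (LinearMap.ker (radMap A B C)) = finrank F (A ⊓ B ⊓ C : Submodule F V) := by
  symm
  refine LinearEquiv.finrank_eq (LinearEquiv.ofBijective (LinearMap.codRestrict _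
    { toFun := fun x => (⟨x, x.2.1⟩, ⟨-x, neg_mem (⟨x.2.1.1, x.2.2⟩ : (x : V) ∈ A ⊓ C)⟩,
        ⟨x, ⟨x.2.1.2, x.2.2⟩⟩)
      map_add' := fun x y => by
        refine Prod.ext (Subtype.ext ?_) (Prod.ext (Subtype.ext ?_) (Subtype.ext ?_))
        · simp
        · simp; abel
        · simp
      map_smul' := fun c x => by
        refine Prod.ext (Subtype.ext ?_) (Prod.ext (Subtype.ext ?_) (Subtype.ext ?_)) <;> simp }
    fun x => ?_) ⟨?_, ?_⟩)
  · rw [LinearMap.mem_ker]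
    refine Prod.ext (Subtype.ext ?_) (Prod.ext (Subtype.ext ?_) (Subtype.ext ?_)) <;>
    simp [radMap]
  · intro x y h
    have := congrArg (fun z => (z.1.1 : V)) h
    exact Subtype.ext this
  · rintro ⟨⟨x, y, z⟩, h⟩
    rw [LinearMap.mem_ker] at h
    have h1 : (x : V) + y = 0 := congrArg (fun z => (z.1 : V)) h
    have h2 : -(x : V) + z = 0 := congrArg (fun z => (z.2.1 : V)) h
    have h3 : (z : V) = x := by rw [neg_add_eq_zero] at h2; exact h2.symm
    have h4 : (y : V) = -x := (neg_eq_of_add_eq_zero_right h1).symm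
    refine ⟨⟨x, x.2, ?_⟩, Subtype.ext (Prod.ext rfl (Prod.ext (Subtype.ext ?_) (Subtype.ext ?_)))⟩
    · rw [← h3]; exact z.2.2
    · exact h4.symm
    · exact h3.symm

theorem TotallySingular.le_orthogonal {U : Submodule F V} (hU : TotallySingular Q U) :
    U ≤ perp Q U := fun _ hx _ hy =>
  polar_eq_zero_of_totallySingular hU hy hx

theorem orthogonal_sup_eq (A B : Submodule F V) : perp Q (A ⊔ B) =
    perp Q A ⊓ perp Q B := by
  refine le_antisymm (le_inf (LinearMap.BilinForm.orthogonal_le le_sup_left)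
    (LinearMap.BilinForm.orthogonal_le le_sup_right)) ?_
  rintro x ⟨hxA, hxB⟩ y hy
  obtain ⟨a, ha, b, hb, rfl⟩ := Submodule.mem_sup.1 hy
  have h1 : polarBilin Q a x = 0 := hxA a ha
  have h2 : polarBilin Q b x = 0 := hxB b hb
  change polarBilin Q (a + b) x = 0
  rw [map_add, LinearMap.add_apply, h1, h2, add_zero]

variable [FiniteDimensional F V]

theorem IsHyperbolic.orthogonal_orthogonal (hQ : IsHyperbolic n Q) (U : Submodule F V) :
    perp Q (perp Q U) = U :=
  LinearMap.BilinForm.orthogonal_orthogonal hQ.nondegenerate (isRefl_polarBilin Q) U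

theorem IsHyperbolic.finrank_orthogonal (hQ : IsHyperbolic n Q) (U : Submodule F V) :
    finrank F (perp Q U) = 2 * n - finrank F U := by
  rw [LinearMap.BilinForm.finrank_orthogonal hQ.nondegenerate, hQ.1]

theorem IsGenerator.orthogonal_eq (hQ : IsHyperbolic n Q) {A : Submodule F V}
    (hA : IsGenerator n Q A) : perp Q A = A := by
  refine (Submodule.eq_of_le_of_finrank_le hA.1.le_orthogonal ?_).symm
  rw [hQ.finrank_orthogonal, hA.2]
  omega

theorem IsGenerator.mem_of_polar_eq_zero (hQ : IsHyperbolic n Q) {A : Submodule F V}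
    (hA : IsGenerator n Q A) {x : V} (hx : ∀ a ∈ A, polar Q a x = 0) : x ∈ A := by
  rw [← hA.orthogonal_eq hQ]
  exact hx

theorem TotallySingular.finrank_le (hQ : IsHyperbolic n Q) {U : Submodule F V}
    (hU : TotallySingular Q U) : finrank F U ≤ n := by
  have h := Submodule.finrank_mono hU.le_orthogonal
  have h2 := Submodule.finrank_le U
  rw [hQ.finrank_orthogonal] at h
  rw [hQ.1] at h2
  omega

theorem IsHyperbolic.orthogonal_inf (hQ : IsHyperbolic n Q) (A B : Submodule F V) :
    perp Q (A ⊓ B) =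
    perp Q A ⊔ perp Q B := by
  rw [← hQ.orthogonal_orthogonal (perp Q A ⊔ perp Q B),
    orthogonal_sup_eq, hQ.orthogonal_orthogonal, hQ.orthogonal_orthogonal]

/-- The codimension modulo two of the intersection is additive on generators. -/
theorem even_finrank_inf_add (hQ : IsHyperbolic n Q) {A B C : Submodule F V}
    (hA : IsGenerator n Q A) (hB : IsGenerator n Q B) (hC : IsGenerator n Q C) :
    Even (n + finrank F (A ⊓ B : Submodule F V) + finrank F (A ⊓ C : Submodule F V) +
      finrank F (B ⊓ C : Submodule F V)) := by
  -- On triples with a + b + c = 0, the form pairing b with c' has diagonal values Q(b + c) = Q(-a)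
  -- = 0, so it is alternating in every characteristic. Its rank is even, and its radical is the
  -- range of `radMap`.
  let W := LinearMap.ker (sumMap A B C)
  let β₀ : LinearMap.BilinForm F (A × B × C) := (polarBilin Q).compl₁₂
    (B.subtype ∘ₗ LinearMap.fst F B C ∘ₗ LinearMap.snd F A (B × C))
    (C.subtype ∘ₗ LinearMap.snd F B C ∘ₗ LinearMap.snd F A (B × C))
  have hW : ∀ p : A × B × C, p ∈ W ↔ (p.1 : V) + (p.2.1 + p.2.2) = 0 := fun p => Iff.rfl
  have halt : (β₀.restrict W).IsAlt := by
    rintro ⟨⟨a, b, c⟩, hp⟩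
    rw [hW] at hp
    change polar Q (b : V) (c : V) = 0
    have hbc : (b : V) + c = -a := by
      rw [eq_neg_iff_add_eq_zero, add_comm]; exact hp
    rw [polar, hbc, QuadraticMap.map_neg, hA.1 _ a.2, hB.1 _ b.2, hC.1 _ c.2]
    simp
  have hrank := even_finrank_add_finrank_ker_of_isAlt _ halt
  have hrad : (LinearMap.ker (β₀.restrict W)).map W.subtype = LinearMap.range (radMap A B C) := by
    ext p
    constructor
    · rintro ⟨⟨⟨a, b, c⟩, hp⟩, hker, rfl⟩
      have hp' : (a : V) + (b + c) = 0 := (hW _).1 hp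
      -- A radical triple has b orthogonal to A ∩ (B + C), whose orthogonal space is A + (B ∩ C)
      -- because generators are their own orthogonal spaces.
      have hb : (b : V) ∈ A ⊔ (B ⊓ C) := by
        rw [← hQ.orthogonal_orthogonal (A ⊔ (B ⊓ C)), orthogonal_sup_eq, hA.orthogonal_eq hQ,
          hQ.orthogonal_inf B C, hB.orthogonal_eq hQ, hC.orthogonal_eq hQ]
        rintro d ⟨hdA, hd⟩
        obtain ⟨b', hb', c', hc', rfl⟩ := Submodule.mem_sup.1 hd
        have hmem : ((⟨-(b' + c'), A.neg_mem hdA⟩, ⟨b', hb'⟩, ⟨c', hc'⟩) : A × B × C) ∈ W := by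
          rw [hW]; simp
        have h1 : polar Q (b : V) c' = 0 :=
          LinearMap.congr_fun (LinearMap.mem_ker.1 hker) ⟨_, hmem⟩
        change polar Q (b' + c') (b : V) = 0
        rw [polar_add_left, polar_eq_zero_of_totallySingular hB.1 hb' b.2, polar_comm, h1, add_zero]
      obtain ⟨a₀, ha₀, t, ht, hsum⟩ := Submodule.mem_sup.1 hb
      have ha₀B : a₀ ∈ B := by
        rw [← eq_sub_iff_add_eq] at hsum
        rw [hsum]
        exact B.sub_mem b.2 ht.1
      have hc : (c : V) = -(a + b) := by
        rw [eq_neg_iff_add_eq_zero, ← hp']; abel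
      have hy : (a : V) + a₀ ∈ A ⊓ C := by
        refine ⟨A.add_mem a.2 ha₀, ?_⟩
        have : (a : V) + a₀ = -c - t := by rw [hc, ← hsum]; abel
        rw [this]
        exact C.sub_mem (C.neg_mem c.2) ht.2
      refine ⟨(⟨-a₀, neg_mem (⟨ha₀, ha₀B⟩ : a₀ ∈ A ⊓ B)⟩, ⟨a + a₀, hy⟩, ⟨t, ht⟩), ?_⟩
      refine Prod.ext (Subtype.ext ?_) (Prod.ext (Subtype.ext ?_) (Subtype.ext ?_))
      · simp [radMap]
      · simpa [radMap] using hsum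
      · simp only [radMap, LinearMap.coe_mk, AddHom.coe_mk, Submodule.subtype_apply]
        rw [hc, ← hsum]; abel
    · rintro ⟨⟨x, y, z⟩, rfl⟩
      have hmem : radMap A B C (x, y, z) ∈ W := by
        rw [hW]; simp [radMap]; abel
      refine ⟨⟨_, hmem⟩, LinearMap.mem_ker.2 (LinearMap.ext ?_), rfl⟩
      rintro ⟨⟨a', b', c'⟩, hp⟩
      have hp' : (a' : V) + (b' + c') = 0 := (hW _).1 hp
      change polar Q (-(x : V) + z) (c' : V) = 0
      have hc' : (c' : V) = -(a' + b') := by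
        rw [eq_neg_iff_add_eq_zero, ← hp']; abel
      rw [polar_add_left, polar_eq_zero_of_totallySingular hC.1 z.2.2 c'.2, hc', polar_neg_right,
        polar_neg_left, polar_add_right, polar_eq_zero_of_totallySingular hA.1 x.2.1 a'.2,
        polar_eq_zero_of_totallySingular hB.1 x.2.2 b'.2]
      simp
  have e1 : finrank F (LinearMap.ker (β₀.restrict W)) = finrank F (LinearMap.range (radMap A B C)) := by
    rw [← hrad, Submodule.finrank_map_subtype_eq]
  have e2 := LinearMap.finrank_range_add_finrank_ker (radMap A B C)
  have e3 := LinearMap.finrank_range_add_finrank_ker (sumMap A B C)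
  have e4 : finrank F (LinearMap.range (sumMap A B C)) =
      2 * n - finrank F (A ⊓ (B ⊓ C) : Submodule F V) := by
    rw [range_sumMap, ← hQ.finrank_orthogonal, hQ.orthogonal_inf, hQ.orthogonal_inf,
      hA.orthogonal_eq hQ, hB.orthogonal_eq hQ, hC.orthogonal_eq hQ]
  have e5 : finrank F (A ⊓ (B ⊓ C) : Submodule F V) ≤ n := by
    rw [← hA.2]; exact Submodule.finrank_mono inf_le_left
  -- With t = dim(A ∩ B ∩ C), dim W = 3n - (2n - t) = n + t, and the radical has dimension the sum
  -- of the pairwise ones minus t; t cancels in the total.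
  rw [finrank_ker_radMap, inf_assoc] at e2
  rw [Module.finrank_prod, Module.finrank_prod] at e2 e3
  rw [hA.2, hB.2, hC.2, e4] at e3
  rw [Nat.even_iff] at hrank ⊢
  change (finrank F (LinearMap.ker (sumMap A B C)) + _) % 2 = 0 at hrank
  omega

end Perp

end Oriflamme

namespace Oriflamme

open Module

/-! ### Reflections and transitivity on singular vectors -/

section Isometries

variable {F V : Type*} [Field F] [AddCommGroup V] [Module F V] {Q : QuadraticForm F V} {n : ℕ}

open QuadraticMap

theorem polar_self_eq_zero {p : V} (hp : Q p = 0) : polar Q p p = 0 := by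
  rw [polar_self, hp, smul_zero]

theorem map_add_eq (Q : QuadraticForm F V) (x y : V) : Q (x + y) = Q x + Q y + polar Q x y := by
  rw [polar]; ring

/-- The reflection in the nonsingular vector `v`. -/
noncomputable def reflection (Q : QuadraticForm F V) {v : V} (hv : Q v ≠ 0) : V ≃ₗ[F] V :=
  LinearEquiv.ofInvolutive
    (LinearMap.id - (((Q v)⁻¹ • (polarBilin Q).flip v).smulRight v)) fun x => by
    simp only [LinearMap.sub_apply, LinearMap.id_apply, LinearMap.smulRight_apply,
      LinearMap.smul_apply, LinearMap.flip_apply, polarBilin_apply_apply, polar_sub_left,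
      polar_smul_left, polar_self, smul_eq_mul, nsmul_eq_mul, sub_smul, mul_sub]
    have : (Q v)⁻¹ * ((Q v)⁻¹ * polar Q x v * ((2 : ℕ) * Q v)) = 2 * ((Q v)⁻¹ * polar Q x v) := by
      field_simp
      push_cast
      ring
    rw [this, two_mul, add_smul]
    abel

theorem reflection_apply {v : V} (hv : Q v ≠ 0) (x : V) :
    reflection Q hv x = x - ((Q v)⁻¹ * polar Q x v) • v := rfl

theorem map_reflection {v : V} (hv : Q v ≠ 0) (x : V) : Q (reflection Q hv x) = Q x := by
  rw [reflection_apply, sub_eq_add_neg, map_add_eq, QuadraticMap.map_neg, QuadraticMap.map_smul,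
    polar_neg_right, polar_smul_right, smul_eq_mul, smul_eq_mul]
  field_simp
  ring

/-- The vector p - p' is nonsingular, as Q(p - p') = -polar(p, p'), and its reflection takes p to
p', also in characteristic 2. -/
theorem exists_reflection_apply_eq {p p' : V} (hp : Q p = 0) (hp' : Q p' = 0)
    (h : polar Q p p' ≠ 0) : ∃ (v : V) (hv : Q v ≠ 0), reflection Q hv p = p' := by
  have hv : Q (p - p') = -polar Q p p' := by
    rw [sub_eq_add_neg, map_add_eq, QuadraticMap.map_neg, polar_neg_right, hp, hp']
    ring
  refine ⟨p - p', by rwa [hv, neg_ne_zero], ?_⟩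
  rw [reflection_apply, hv, polar_sub_right, polar_self_eq_zero hp, zero_sub,
    inv_mul_cancel₀ (neg_ne_zero.2 h), one_smul, sub_sub_cancel]

theorem totallySingular_map {g : V ≃ₗ[F] V} (hg : ∀ x, Q (g x) = Q x) (U : Submodule F V) :
    TotallySingular Q (U.map (g : V →ₗ[F] V)) ↔ TotallySingular Q U := by
  constructor
  · intro h x hx
    rw [← hg]
    exact h _ (Submodule.mem_map_of_mem hx)
  · rintro h _ ⟨x, hx, rfl⟩
    exact (hg x).trans (h x hx)

theorem isGenerator_map {g : V ≃ₗ[F] V} (hg : ∀ x, Q (g x) = Q x) (U : Submodule F V) :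
    IsGenerator n Q (U.map (g : V →ₗ[F] V)) ↔ IsGenerator n Q U := by
  rw [IsGenerator, IsGenerator, totallySingular_map hg, LinearEquiv.finrank_map_eq]

theorem finrank_ker_add_one {U : Type*} [AddCommGroup U] [Module F U] [FiniteDimensional F U]
    {f : U →ₗ[F] F} (hf : f ≠ 0) : finrank F (LinearMap.ker f) + 1 = finrank F U := by
  rw [← LinearMap.finrank_range_add_finrank_ker f,
    LinearMap.range_eq_top.2 (LinearMap.surjective hf), finrank_top, finrank_self, add_comm]

/-- A reflection maps a generator to one that meets it in a hyperplane. -/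
theorem finrank_inf_map_reflection [FiniteDimensional F V] (hQ : IsHyperbolic n Q) {v : V}
    (hv : Q v ≠ 0) {U : Submodule F V} (hU : IsGenerator n Q U) :
    finrank F (U ⊓ U.map (reflection Q hv : V →ₗ[F] V) : Submodule F V) + 1 = n := by
  have hvU : v ∉ U := fun h => hv (hU.1 v h)
  -- U is its own orthogonal space and v is not in U. The vectors of U orthogonal to v form a
  -- hyperplane that is fixed pointwise, while u is moved out of U.
  obtain ⟨u, hu, huv⟩ : ∃ u ∈ U, polar Q u v ≠ 0 := by
    by_contra! h
    exact hvU (hU.mem_of_polar_eq_zero hQ h)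
  let f : U →ₗ[F] F := (polarBilin Q).flip v ∘ₗ U.subtype
  have hf : f ≠ 0 := fun h => huv (LinearMap.congr_fun h ⟨u, hu⟩)
  have hker := finrank_ker_add_one hf
  have hle : (LinearMap.ker f).map U.subtype ≤ U ⊓ U.map (reflection Q hv : V →ₗ[F] V) := by
    rintro _ ⟨x, hx, rfl⟩
    refine ⟨x.2, x, x.2, ?_⟩
    have hx' : polar Q (x : V) v = 0 := hx
    change reflection Q hv (x : V) = x
    rw [reflection_apply, hx', mul_zero, zero_smul, sub_zero]
  have h1 := Submodule.finrank_mono hle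
  rw [Submodule.finrank_map_subtype_eq] at h1
  have hlt : U ⊓ U.map (reflection Q hv : V →ₗ[F] V) < U := by
    refine lt_of_le_of_ne inf_le_left fun h => ?_
    have heq : U = U.map (reflection Q hv : V →ₗ[F] V) :=
      Submodule.eq_of_le_of_finrank_eq (inf_eq_left.1 h) (LinearEquiv.finrank_map_eq _ _).symm
    have hmem : reflection Q hv u ∈ U := by
      rw [heq]; exact Submodule.mem_map_of_mem hu
    rw [reflection_apply, U.sub_mem_iff_right hu,
      U.smul_mem_iff (mul_ne_zero (inv_ne_zero hv) huv)] at hmem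
    exact hvU hmem
  have h2 := Submodule.finrank_lt_finrank_of_lt hlt
  rw [hU.2] at h2 hker
  omega

/-- A reflection interchanges the two classes of generators. -/
theorem odd_finrank_inf_add_map_reflection [FiniteDimensional F V] (hQ : IsHyperbolic n Q) {v : V}
    (hv : Q v ≠ 0) {U E : Submodule F V} (hU : IsGenerator n Q U) (hE : IsGenerator n Q E) :
    Odd (finrank F (U ⊓ E : Submodule F V) +
      finrank F (U.map (reflection Q hv : V →ₗ[F] V) ⊓ E : Submodule F V)) := by
  have h := even_finrank_inf_add hQ hU ((isGenerator_map (map_reflection hv) U).2 hU) hE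
  have h' := finrank_inf_map_reflection hQ hv hU
  rw [Nat.even_iff] at h
  rw [Nat.odd_iff]
  omega

/-! ### Polar frames and type-preserving isometries -/

section Frame

variable {e : Fin n × ℤˣ → V}

/-- Pairing a relation with e_{-a} isolates the coefficient of e_a. -/
theorem IsPolarFrame.linearIndependent (he : IsPolarFrame Q e) : LinearIndependent F e := by
  classical
  rw [Fintype.linearIndependent_iff]
  intro c hc a
  have h : polarBilin Q (e (a.1, -a.2)) (∑ i, c i • e i) = 0 := by rw [hc, map_zero]
  rw [map_sum, Finset.sum_eq_single a] at h
  · rw [map_smul, polarBilin_apply_apply, smul_eq_mul, mul_eq_zero] at h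
    refine h.resolve_right fun h0 => ?_
    exact (he.2 _ _).1 h0 (by simp)
  · intro b _ hb
    rw [map_smul, polarBilin_apply_apply, (he.2 _ _).2, smul_zero]
    simpa using hb
  · simp

theorem totallySingular_span {s : Set V} (h0 : ∀ x ∈ s, Q x = 0)
    (h1 : ∀ x ∈ s, ∀ y ∈ s, polar Q x y = 0) : TotallySingular Q (Submodule.span F s) := by
  have hs : s ⊆ perp Q (Submodule.span F s) := by
    intro x hx
    have : Submodule.span F s ≤ perp Q (F ∙ x) := by
      rw [Submodule.span_le]
      intro y hy z hz
      obtain ⟨c, rfl⟩ := Submodule.mem_span_singleton.1 hz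
      change polar Q (c • x) y = 0
      rw [polar_smul_left, h1 x hx y hy, smul_zero]
    intro y hy
    have h2 : polar Q x y = 0 := this hy x (Submodule.mem_span_singleton_self x)
    change polar Q y x = 0
    rw [polar_comm, h2]
  intro x hx
  induction hx using Submodule.span_induction with
  | mem x hx => exact h0 x hx
  | zero => exact QuadraticMap.map_zero Q
  | add x y hx hy hx' hy' =>
    have : polar Q x y = 0 := Submodule.span_le.2 hs hy x hx
    rw [map_add_eq, hx', hy', this]; simp
  | smul c x _ hx => rw [QuadraticMap.map_smul, hx, smul_zero]

theorem IsPolarFrame.isGenerator (he : IsPolarFrame Q e) : IsGenerator n Q (frameSpace e .gen) := by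
  constructor
  · refine totallySingular_span ?_ ?_
    · rintro _ ⟨a, -, rfl⟩
      exact he.1 a
    · rintro _ ⟨a, ha, rfl⟩ _ ⟨b, hb, rfl⟩
      refine (he.2 a b).2 fun h => ?_
      have h2 : b.2 = -a.2 := congrArg Prod.snd h
      rw [show a.2 = 1 from ha, show b.2 = 1 from hb] at h2
      exact absurd h2 (by decide)
  · have hset : e '' {a | a.2 = 1} = Set.range fun i : Fin n => e (i, 1) := by
      ext x
      constructor
      · rintro ⟨⟨i, ε⟩, rfl, rfl⟩
        exact ⟨i, rfl⟩
      · rintro ⟨i, rfl⟩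
        exact ⟨(i, 1), rfl, rfl⟩
    rw [frameSpace, hset, finrank_span_eq_card, Fintype.card_fin]
    exact he.linearIndependent.comp (fun i : Fin n => (i, (1 : ℤˣ)))
      fun i j h => congrArg Prod.fst h

/-- The product of two reflections preserves types. -/
theorem trans_reflection_mem_isometryGroup [FiniteDimensional F V] (hQ : IsHyperbolic n Q)
    (he : IsPolarFrame Q e) {v w : V} (hv : Q v ≠ 0) (hw : Q w ≠ 0) :
    (reflection Q hv).trans (reflection Q hw) ∈ isometryGroup Q e := by
  set g := (reflection Q hv).trans (reflection Q hw) with hg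
  have hiso : ∀ x, Q (g x) = Q x := fun x => (map_reflection hw _).trans (map_reflection hv x)
  refine ⟨hiso, ?_⟩
  have hpar : ∀ U : Submodule F V, IsGenerator n Q U →
      (finrank F (U.map (g : V →ₗ[F] V) ⊓ frameSpace e .gen : Submodule F V) ≡ n [MOD 2] ↔
        finrank F (U ⊓ frameSpace e .gen : Submodule F V) ≡ n [MOD 2]) := by
    intro U hU
    have h1 := odd_finrank_inf_add_map_reflection hQ hv hU he.isGenerator
    have h2 := odd_finrank_inf_add_map_reflection hQ hw
      ((isGenerator_map (map_reflection hv) U).2 hU) he.isGenerator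
    rw [← Submodule.map_comp] at h2
    rw [Nat.odd_iff] at h1 h2
    change (_ + finrank F (U.map (g : V →ₗ[F] V) ⊓ frameSpace e .gen : Submodule F V)) % 2 = 1 at h2
    rw [Nat.ModEq, Nat.ModEq]
    omega
  intro j U
  cases j with
  | sub i =>
    change _ ∧ _ ↔ _ ∧ _
    rw [totallySingular_map hiso, LinearEquiv.finrank_map_eq]
  | gen =>
    change _ ∧ _ ↔ _ ∧ _
    rw [isGenerator_map hiso]
    exact and_congr_right (hpar U)
  | gen' =>
    change _ ∧ _ ↔ _ ∧ _
    rw [isGenerator_map hiso]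
    exact and_congr_right fun hU => not_congr (hpar U hU)

theorem exists_polar_ne_zero (hQ : IsHyperbolic n Q) {p : V} (hp0 : p ≠ 0) :
    ∃ z, polar Q z p ≠ 0 := by
  by_contra! h
  exact hp0 (hQ.2.1 p fun y => by rw [polarBilin_apply_apply, polar_comm, h y])

/-- A singular point that is collinear with neither of two given singular points. -/
theorem exists_singular_polar_ne_zero [FiniteDimensional F V] (hn : 3 ≤ n) (hQ : IsHyperbolic n Q)
    {p p' : V} (hp : Q p = 0) (hp' : Q p' = 0) (hp0 : p ≠ 0) (hp0' : p' ≠ 0) :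
    ∃ r, Q r = 0 ∧ polar Q r p ≠ 0 ∧ polar Q r p' ≠ 0 := by
  by_cases hc : polar Q p p' = 0
  -- Two proper subspaces, the orthogonal spaces of p and p', do not cover V.
  · obtain ⟨z, hz, hz'⟩ : ∃ z, polar Q z p ≠ 0 ∧ polar Q z p' ≠ 0 := by
      obtain ⟨z, hz⟩ := exists_polar_ne_zero hQ hp0
      obtain ⟨z', hz'⟩ := exists_polar_ne_zero hQ hp0'
      by_cases h1 : polar Q z p' = 0
      · by_cases h2 : polar Q z' p = 0
        · refine ⟨z + z', ?_, ?_⟩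
          · rwa [polar_add_left, h2, add_zero]
          · rwa [polar_add_left, h1, zero_add]
        · exact ⟨z', h2, hz'⟩
      · exact ⟨z, hz, h1⟩
    -- The multiple of p makes z singular and, p being orthogonal to p and p', leaves both pairings
    -- unchanged.
    refine ⟨z + (-(Q z) / polar Q z p) • p, ?_, ?_, ?_⟩
    · rw [map_add_eq, QuadraticMap.map_smul, hp, polar_smul_right, smul_eq_mul, smul_eq_mul,
        div_mul_cancel₀ _ hz]
      ring
    · rwa [polar_add_left, polar_smul_left, polar_self_eq_zero hp, smul_zero, add_zero]
    · rwa [polar_add_left, polar_smul_left, hc, smul_zero, add_zero]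
  -- The orthogonal space of p and p' has dimension at least 2n - 2 > n, too large to be totally
  -- singular; this needs n ≥ 3.
  · obtain ⟨z, hz, hzp, hzp'⟩ : ∃ z, Q z ≠ 0 ∧ polar Q p z = 0 ∧ polar Q p' z = 0 := by
      by_contra! h
      have hts : TotallySingular Q (perp Q (Submodule.span F (Set.range ![p, p']))) := by
        intro z hz
        by_contra hz0
        exact h z hz0 (hz p (Submodule.subset_span ⟨0, rfl⟩))
          (hz p' (Submodule.subset_span ⟨1, rfl⟩))
      have h1 := hts.finrank_le hQ
      have h2 := finrank_range_le_card (R := F) ![p, p']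
      rw [Set.finrank, Fintype.card_fin] at h2
      rw [hQ.finrank_orthogonal] at h1
      omega
    -- The coefficient makes the part in ⟨p, p'⟩ have value -Q(z), which cancels Q(z). The pairings
    -- with p and p' are then -Q(z) and polar(p, p').
    refine ⟨p + (-(Q z) / polar Q p p') • p' + z, ?_, ?_, ?_⟩
    · rw [map_add_eq, map_add_eq, QuadraticMap.map_smul, hp, hp', polar_smul_right, polar_add_left,
        polar_smul_left, hzp, hzp', smul_eq_mul, smul_eq_mul, smul_eq_mul, div_mul_cancel₀ _ hc]
      ring
    · rw [polar_add_left, polar_add_left, polar_smul_left, polar_self_eq_zero hp, polar_comm Q p',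
        polar_comm Q z, hzp, smul_eq_mul, div_mul_cancel₀ _ hc]
      simpa using hz
    · rwa [polar_add_left, polar_add_left, polar_smul_left, polar_self_eq_zero hp',
        polar_comm Q z, hzp', smul_zero, add_zero, add_zero]

/-- The type-preserving isometries are transitive on nonzero singular vectors. -/
theorem exists_mem_isometryGroup_apply_eq [FiniteDimensional F V] (hn : 3 ≤ n)
    (hQ : IsHyperbolic n Q) (he : IsPolarFrame Q e)
    {p p' : V} (hp : Q p = 0) (hp' : Q p' = 0) (hp0 : p ≠ 0) (hp0' : p' ≠ 0) :
    ∃ g ∈ isometryGroup Q e, g p = p' := by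
  obtain ⟨r, hr, h1, h2⟩ := exists_singular_polar_ne_zero hn hQ hp hp' hp0 hp0'
  rw [polar_comm] at h1
  obtain ⟨v, hv, hvr⟩ := exists_reflection_apply_eq hp hr h1
  obtain ⟨w, hw, hwr⟩ := exists_reflection_apply_eq hr hp' h2
  refine ⟨_, trans_reflection_mem_isometryGroup hQ he hv hw, ?_⟩
  rw [LinearEquiv.trans_apply, hvr, hwr]

variable {J : Set (Node n)}

/-- The action of type-preserving isometries on flags. -/
def Flag.map (g : V ≃ₗ[F] V) (hg : g ∈ isometryGroup Q e) (x : Flag Q e J) : Flag Q e J where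
  elt j hj := (x.elt j hj).map (g : V →ₗ[F] V)
  hasType j hj := (hg.2 j _).2 (x.hasType j hj)
  incident j hj k hk := by
    rcases x.incident j hj k hk with h | h | ⟨h, h'⟩
    · exact Or.inl (Submodule.map_mono h)
    · exact Or.inr (Or.inl (Submodule.map_mono h))
    · refine Or.inr (Or.inr ⟨h, ?_⟩)
      rw [← Submodule.map_inf _ g.injective, LinearEquiv.finrank_map_eq]
      exact h'

theorem Flag.map_injective (g : V ≃ₗ[F] V) (hg : g ∈ isometryGroup Q e) :
    Function.Injective (Flag.map g hg : Flag Q e J → Flag Q e J) := by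
  intro x y h
  refine Flag.ext (funext fun j => funext fun hj => ?_)
  exact Submodule.map_injective_of_injective g.injective (congrArg (fun z => z.elt j hj) h)


end Frame

end Isometries

end Oriflamme

namespace Oriflamme

open Module

/-! ### Double counting of singular vectors and flags -/

section Counting

open QuadraticMap

theorem sum_natCard_comm {X Y : Type*} [Fintype X] [Fintype Y] (r : X → Y → Prop) :
    ∑ x, Nat.card {y // r x y} = ∑ y, Nat.card {x // r x y} := by
  rw [← Nat.card_sigma, ← Nat.card_sigma]
  exact Nat.card_congr
    { toFun := fun p => ⟨p.2.1, p.1, p.2.2⟩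
      invFun := fun p => ⟨p.2.1, p.1, p.2.2⟩
      left_inv := fun _ => rfl
      right_inv := fun _ => rfl }

open Classical in
theorem sum_ite_mem_eq {X : Type*} [Fintype X] (C : Set X) (a b : ℚ) :
    ∑ x, (if x ∈ C then a else b) = C.ncard * (a - b) + Nat.card X * b := by
  have h : ∀ x, (if x ∈ C then a else b) = (if x ∈ C then a - b else 0) + b := by
    intro x; split_ifs <;> ring
  simp_rw [h]
  rw [Finset.sum_add_distrib, ← Finset.sum_filter, Finset.sum_const, Finset.sum_const,
    Set.ncard_eq_toFinset_card', Nat.card_eq_fintype_card, nsmul_eq_mul, nsmul_eq_mul,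
    Set.filter_mem_univ_eq_toFinset, Finset.card_univ]

variable {F V : Type*} [Field F] [AddCommGroup V] [Module F V] {Q : QuadraticForm F V} {n : ℕ}

theorem natCard_fiber [Finite F] {U : Type*} [AddCommGroup U] [Module F U] [FiniteDimensional F U]
    {f : U →ₗ[F] F} (hf : f ≠ 0) (c : F) :
    Nat.card {x // f x = c} = Nat.card F ^ (finrank F U - 1) := by
  obtain ⟨x₀, hx₀⟩ := LinearMap.surjective hf c
  have e : {x // f x = c} ≃ LinearMap.ker f :=
    { toFun := fun x => ⟨x - x₀, by rw [LinearMap.mem_ker, map_sub, x.2, hx₀, sub_self]⟩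
      invFun := fun x => ⟨x + x₀, by rw [map_add, LinearMap.mem_ker.1 x.2, hx₀, zero_add]⟩
      left_inv := fun x => by simp
      right_inv := fun x => by simp }
  rw [Nat.card_congr e, Module.natCard_eq_pow_finrank (K := F), ← finrank_ker_add_one hf,
    Nat.add_sub_cancel]

/-- The nonzero singular vectors. -/
def SingularVector (Q : QuadraticForm F V) : Type _ := {p : V // p ≠ 0 ∧ Q p = 0}

instance [Finite V] (Q : QuadraticForm F V) : Finite (SingularVector Q) :=
  inferInstanceAs (Finite {p : V // p ≠ 0 ∧ Q p = 0})

theorem natCard_singularVector_mem [Finite F] [FiniteDimensional F V] {U : Submodule F V}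
    (hU : TotallySingular Q U) :
    (Nat.card {p : SingularVector Q // p.1 ∈ U} : ℚ) = (Nat.card F : ℚ) ^ finrank F U - 1 := by
  have : Finite V := Module.finite_of_finite F
  have e : Option {p : SingularVector Q // p.1 ∈ U} ≃ U := by
    classical
    exact
    { toFun := fun o => o.elim 0 fun p => ⟨p.1.1, p.2⟩
      invFun := fun u => if h : u = 0 then none else
        some ⟨⟨u, fun h' => h (Subtype.ext h'), hU _ u.2⟩, u.2⟩
      left_inv := by
        rintro (_ | ⟨⟨p, hp, hp'⟩, hpU⟩)
        · simp
        · have : (⟨p, hpU⟩ : U) ≠ 0 := fun h => hp (congrArg Subtype.val h)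
          simp [this]
      right_inv := by
        intro u
        by_cases h : u = 0 <;> simp [h] }
  have h := Nat.card_congr e
  rw [Finite.card_option, Module.natCard_eq_pow_finrank (K := F) (V := U)] at h
  rw [eq_sub_iff_add_eq]
  exact_mod_cast h

/-- Count pairs (z, m) in V × M with Q(z + m) = 0 for a generator M. Each m contributes a translate
of the quadric. For fixed z, Q(z + m) = Q(z) + polar(z, m) vanishes for all m if z is in M, and
otherwise on a fibre of a nonzero linear form, as M is its own orthogonal space. -/
theorem natCard_singular [Finite F] [FiniteDimensional F V]
    (hQ : IsHyperbolic n Q) :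
    (Nat.card {x // Q x = 0} : ℚ) = (Nat.card F : ℚ) ^ n * (Nat.card F : ℚ) ^ (n - 1) +
      (Nat.card F : ℚ) ^ n - (Nat.card F : ℚ) ^ (n - 1) := by
  classical
  have : Finite V := Module.finite_of_finite F
  have := Fintype.ofFinite V
  obtain ⟨M, hM⟩ := hQ.2.2
  have hMg : IsGenerator n Q M := hM
  have key := sum_natCard_comm fun (z : V) (m : M) => Q (z + m) = 0
  have h1 : ∀ m : M, Nat.card {z : V // Q (z + m) = 0} = Nat.card {x // Q x = 0} := fun m =>
    Nat.card_congr ((Equiv.addRight (m : V)).subtypeEquiv fun _ => Iff.rfl)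
  have hMc : Nat.card M = Nat.card F ^ n := by
    rw [Module.natCard_eq_pow_finrank (K := F), hM.2]
  have h2 : ∀ z : V, (Nat.card {m : M // Q (z + m) = 0} : ℚ) =
      if z ∈ (M : Set V) then (Nat.card F : ℚ) ^ n else (Nat.card F : ℚ) ^ (n - 1) := by
    intro z
    split_ifs with hz
    · rw [← Nat.cast_pow, ← hMc, Nat.card_congr (Equiv.subtypeUnivEquiv fun m : M =>
        hM.1 _ (M.add_mem hz m.2))]
    · let f : M →ₗ[F] F := polarBilin Q z ∘ₗ M.subtype
      have hf : f ≠ 0 := fun h => hz (hMg.mem_of_polar_eq_zero hQ fun a ha => by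
        rw [polar_comm]
        exact LinearMap.congr_fun h ⟨a, ha⟩)
      rw [← Nat.cast_pow]
      conv_rhs => rw [← hM.2, ← natCard_fiber hf (-Q z)]
      refine congrArg _ (Nat.card_congr (Equiv.subtypeEquivRight fun m => ?_))
      rw [map_add_eq, hM.1 _ m.2, add_zero, eq_neg_iff_add_eq_zero, add_comm]
      rfl
  have key' := congrArg (Nat.cast : ℕ → ℚ) key
  simp_rw [h1] at key'
  rw [Nat.cast_sum] at key'
  simp_rw [h2] at key'
  rw [sum_ite_mem_eq, Finset.sum_const, Finset.card_univ, ← Nat.card_eq_fintype_card, hMc,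
    Module.natCard_eq_pow_finrank (K := F) (V := V), hQ.1, ← Nat.card_coe_set_eq] at key'
  have hMc' : Nat.card (M : Set V) = Nat.card F ^ n := hMc
  rw [hMc', two_mul, pow_add] at key'
  push_cast [nsmul_eq_mul] at key'
  have hq : (Nat.card F : ℚ) ^ n ≠ 0 := pow_ne_zero _ (Nat.cast_ne_zero.2 Nat.card_pos.ne')
  refine mul_left_cancel₀ hq ?_
  rw [← key']
  ring

theorem natCard_singularVector [Finite F] [FiniteDimensional F V]
    (hQ : IsHyperbolic n Q) :
    (Nat.card (SingularVector Q) : ℚ) =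
      ((Nat.card F : ℚ) ^ n - 1) * (1 + (Nat.card F : ℚ) ^ (n - 1)) := by
  have : Finite V := Module.finite_of_finite F
  have e : Option (SingularVector Q) ≃ {x // Q x = 0} := by
    classical
    exact
    { toFun := fun o => o.elim ⟨0, QuadraticMap.map_zero Q⟩ fun p => ⟨p.1, p.2.2⟩
      invFun := fun u => if h : u.1 = 0 then none else some ⟨u, h, u.2⟩
      left_inv := by
        rintro (_ | ⟨p, hp, hp'⟩)
        · simp
        · exact dif_neg hp
      right_inv := by
        rintro ⟨u, hu⟩
        by_cases h : u = 0
        · simp [h]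
        · simp only [h, dite_false]
          rfl }
  have h := congrArg (Nat.cast : ℕ → ℚ) (Nat.card_congr e)
  rw [Finite.card_option, natCard_singular hQ] at h
  push_cast at h
  linear_combination h

instance (n : ℕ) : Finite (Node n) :=
  Finite.of_surjective (Sum.elim Node.sub fun b : Bool => if b then .gen else .gen') fun j => by
    cases j with
    | sub i => exact ⟨.inl i, rfl⟩
    | gen => exact ⟨.inr true, rfl⟩
    | gen' => exact ⟨.inr false, rfl⟩

variable {e : Fin n × ℤˣ → V} {J : Set (Node n)}

instance [Finite V] : Finite (Flag Q e J) :=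
  Finite.of_injective (fun x : Flag Q e J => x.elt) fun _ _ h => Flag.ext h

theorem HasType.totallySingular {j : Node n} {U : Submodule F V} (h : HasType Q e j U) :
    TotallySingular Q U := by
  cases j with
  | sub i => exact h.1
  | gen => exact h.1.1
  | gen' => exact h.1.1

/-- A type-preserving isometry taking p to p' injects one set of flags into the other; exchanging p
and p' gives equality. -/
theorem natCard_flag_le [Finite V] [FiniteDimensional F V] (hn : 3 ≤ n)
    (hQ : IsHyperbolic n Q) (he : IsPolarFrame Q e) {j : Node n} (hj : j ∈ J)
    (p p' : SingularVector Q) :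
    Nat.card {x : Flag Q e J // p.1 ∈ x.elt j hj} ≤
      Nat.card {x : Flag Q e J // p'.1 ∈ x.elt j hj} := by
  obtain ⟨g, hg, hgp⟩ :=
    exists_mem_isometryGroup_apply_eq hn hQ he p.2.2 p'.2.2 p.2.1 p'.2.1
  refine Nat.card_le_card_of_injective
    (fun x => ⟨Flag.map g hg x.1, by rw [← hgp]; exact Submodule.mem_map_of_mem x.2⟩) ?_
  intro x y h
  exact Subtype.ext (Flag.map_injective g hg (congrArg Subtype.val h))

/-- Counting pairs of a singular vector of `M` and a flag whose element of type `j` contains it. -/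
theorem sum_flag_finrank_inf [Finite F] [FiniteDimensional F V] [Fintype (Flag Q e J)]
    (hn : 3 ≤ n) (hQ : IsHyperbolic n Q) (he : IsPolarFrame Q e) {j : Node n} (hj : j ∈ J)
    {d : ℕ} (hd : ∀ x : Flag Q e J, finrank F (x.elt j hj) = d) {M : Submodule F V}
    (hM : TotallySingular Q M) :
    ((Nat.card F : ℚ) ^ n - 1) * (1 + (Nat.card F : ℚ) ^ (n - 1)) *
      ∑ x : Flag Q e J, ((Nat.card F : ℚ) ^ finrank F (x.elt j hj ⊓ M : Submodule F V) - 1) =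
    ((Nat.card F : ℚ) ^ finrank F M - 1) * ((Nat.card F : ℚ) ^ d - 1) *
      Nat.card (Flag Q e J) := by
  classical
  have : Finite V := Module.finite_of_finite F
  have := Fintype.ofFinite (SingularVector Q)
  obtain ⟨c, hc⟩ : ∃ c : ℕ, ∀ p : SingularVector Q,
      Nat.card {x : Flag Q e J // p.1 ∈ x.elt j hj} = c := by
    rcases isEmpty_or_nonempty (SingularVector Q) with h | ⟨⟨p⟩⟩
    · exact ⟨0, fun p => h.elim p⟩
    · exact ⟨_, fun p' => le_antisymm (natCard_flag_le hn hQ he hj p' p)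
        (natCard_flag_le hn hQ he hj p p')⟩
  have hts : ∀ x : Flag Q e J, TotallySingular Q (x.elt j hj) := fun x =>
    (x.hasType j hj).totallySingular
  have h1 := congrArg (Nat.cast : ℕ → ℚ)
    (sum_natCard_comm fun (x : Flag Q e J) (p : SingularVector Q) => p.1 ∈ x.elt j hj)
  simp_rw [hc] at h1
  rw [Nat.cast_sum] at h1
  simp_rw [natCard_singularVector_mem (hts _), hd] at h1
  rw [Finset.sum_const, Finset.sum_const, Finset.card_univ, Finset.card_univ,
    ← Nat.card_eq_fintype_card, ← Nat.card_eq_fintype_card, nsmul_eq_mul, smul_eq_mul,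
    Nat.cast_mul, natCard_singularVector hQ] at h1
  have h2 := congrArg (Nat.cast : ℕ → ℚ)
    (sum_natCard_comm fun (x : Flag Q e J) (p : SingularVector Q) => p.1 ∈ x.elt j hj ⊓ M)
  have h3 : ∀ p : SingularVector Q, Nat.card {x : Flag Q e J // p.1 ∈ x.elt j hj ⊓ M} =
      if p ∈ {p : SingularVector Q | p.1 ∈ M} then c else 0 := by
    intro p
    split_ifs with h
    · rw [← hc p]
      exact Nat.card_congr (Equiv.subtypeEquivRight fun x => ⟨fun h' => h'.1, fun h' => ⟨h', h⟩⟩)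
    · have : IsEmpty {x : Flag Q e J // p.1 ∈ x.elt j hj ⊓ M} := ⟨fun x => h x.2.2⟩
      exact Nat.card_of_isEmpty
  simp_rw [h3] at h2
  rw [Nat.cast_sum, Nat.cast_sum] at h2
  have hts' : ∀ x : Flag Q e J, TotallySingular Q (x.elt j hj ⊓ M) := fun x y hy => hM y hy.2
  simp_rw [natCard_singularVector_mem (hts' _), Nat.cast_ite] at h2
  rw [sum_ite_mem_eq, ← Nat.card_coe_set_eq] at h2
  have h4 : (Nat.card {p : SingularVector Q | p.1 ∈ M} : ℚ) = _ := natCard_singularVector_mem hM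
  rw [h4] at h2
  push_cast at h2
  -- `h2` counts only the vectors in M, `h1` all singular vectors; combining them eliminates c.
  rw [h2]
  linear_combination (-((Nat.card F : ℚ) ^ finrank F M - 1)) * h1

/-- If two values are possible for the dimension of the intersection of `M` with the element of
type `j` of a flag, this determines the number of flags for either of them. -/
theorem meetsBound_of_finrank_inf [Finite F] [FiniteDimensional F V]
    (hn : 3 ≤ n) (hQ : IsHyperbolic n Q) (he : IsPolarFrame Q e) {j : Node n} (hj : j ∈ J)
    {d : ℕ} (hd : ∀ x : Flag Q e J, finrank F (x.elt j hj) = d) {M : Submodule F V}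
    (hM : TotallySingular Q M) {C : Set (Flag Q e J)} {a b : ℕ} (hba : b < a)
    (ha : ∀ x ∈ C, finrank F (x.elt j hj ⊓ M : Submodule F V) = a)
    (hb : ∀ x ∉ C, finrank F (x.elt j hj ⊓ M : Submodule F V) = b)
    (hab : ((Nat.card F : ℚ) ^ finrank F M - 1) * ((Nat.card F : ℚ) ^ d - 1) =
      ((Nat.card F : ℚ) ^ n - 1) * ((Nat.card F : ℚ) ^ a - (Nat.card F : ℚ) ^ b +
        (1 + (Nat.card F : ℚ) ^ (n - 1)) * ((Nat.card F : ℚ) ^ b - 1))) :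
    MeetsBound C := by
  classical
  have : Finite V := Module.finite_of_finite F
  have := Fintype.ofFinite (Flag Q e J)
  have key := sum_flag_finrank_inf hn hQ he hj hd hM
  have h : ∀ x : Flag Q e J, (Nat.card F : ℚ) ^ finrank F (x.elt j hj ⊓ M : Submodule F V) - 1 =
      if x ∈ C then (Nat.card F : ℚ) ^ a - 1 else (Nat.card F : ℚ) ^ b - 1 := by
    intro x
    split_ifs with hx
    · rw [ha x hx]
    · rw [hb x hx]
  simp_rw [h] at key
  -- The sum is now linear in |C| with slope q^a - q^b ≠ 0; `hab` says that v / (1 + q^(n-1)) is the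
  -- solution.
  rw [sum_ite_mem_eq, hab] at key
  have hq : (1 : ℚ) < Nat.card F := by exact_mod_cast Finite.one_lt_card
  have hqn : (Nat.card F : ℚ) ^ n - 1 ≠ 0 := (sub_pos.2 (one_lt_pow₀ hq (by omega))).ne'
  have hqab : (Nat.card F : ℚ) ^ a - (Nat.card F : ℚ) ^ b ≠ 0 :=
    (sub_pos.2 (pow_lt_pow_right₀ hq hba)).ne'
  rw [MeetsBound, eq_div_iff (by positivity)]
  refine mul_left_cancel₀ (mul_ne_zero hqn hqab) ?_
  linear_combination key

end Counting

end Oriflamme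

namespace Oriflamme

/-! ### The Weyl group of type D_n and its longest element -/

section Weyl

variable {n : ℕ}

/-- The involution `i ↦ -i` on the indices. -/
def opp (a : Fin n × ℤˣ) : Fin n × ℤˣ := (a.1, -a.2)

@[simp]
theorem opp_opp (a : Fin n × ℤˣ) : opp (opp a) = a := by simp [opp]

theorem opp_ne (a : Fin n × ℤˣ) : opp a ≠ a := by
  intro h
  have h2 : -a.2 = a.2 := congrArg Prod.snd h
  rcases Int.units_eq_one_or a.2 with h3 | h3 <;> rw [h3] at h2 <;> exact absurd h2 (by decide)

theorem opp_injective : Function.Injective (opp (n := n)) := fun a b h => by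
  rw [← opp_opp a, h, opp_opp]

theorem eq_or_eq_opp {a b : Fin n × ℤˣ} (h : a.1 = b.1) : a = b ∨ a = opp b := by
  rcases Int.units_eq_one_or a.2 with h1 | h1 <;> rcases Int.units_eq_one_or b.2 with h2 | h2
  · exact Or.inl (Prod.ext h (h1.trans h2.symm))
  · exact Or.inr (Prod.ext h (by simp [opp, h1, h2]))
  · exact Or.inr (Prod.ext h (by simp [opp, h1, h2]))
  · exact Or.inl (Prod.ext h (h1.trans h2.symm))

/-- The pairing of the weight of index `a` with half the sum of the positive roots. -/
def height (a : Fin n × ℤˣ) : ℤ := (a.2 : ℤ) * (n - 1 - a.1)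

theorem height_opp (a : Fin n × ℤˣ) : height (opp a) = -height a := by
  simp [height, opp]

/-- Different underlying indices have heights of different absolute value. Opposite indices must be
excluded because n and -n both have height 0. -/
theorem height_ne {a b : Fin n × ℤˣ} (h : a ≠ b) (h' : a ≠ opp b) : height a ≠ height b := by
  intro hab
  have hne : a.1 ≠ b.1 := fun h1 => (eq_or_eq_opp h1).elim h h'
  have hne' : (a.1 : ℕ) ≠ b.1 := fun h1 => hne (Fin.ext h1)
  have ha := a.1.2
  have hb := b.1.2
  unfold height at hab
  rcases Int.units_eq_one_or a.2 with h1 | h1 <;> rcases Int.units_eq_one_or b.2 with h2 | h2 <;>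
  · rw [h1, h2] at hab
    push_cast at hab
    omega

/-- The reflection in the root of the pair `(a, b)`. -/
def rootReflection (a b : Fin n × ℤˣ) : Equiv.Perm (Fin n × ℤˣ) :=
  Equiv.swap a b * Equiv.swap (opp a) (opp b)

section RootReflection

variable {a b : Fin n × ℤˣ}

theorem rootReflection_left (h : a ≠ opp b) : rootReflection a b a = b := by
  rw [rootReflection, Equiv.Perm.mul_apply,
    Equiv.swap_apply_of_ne_of_ne (opp_ne a).symm h, Equiv.swap_apply_left]

theorem rootReflection_right (h : a ≠ opp b) : rootReflection a b b = a := by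
  rw [rootReflection, Equiv.Perm.mul_apply, Equiv.swap_apply_of_ne_of_ne _ (opp_ne b).symm,
    Equiv.swap_apply_right]
  intro h1
  exact h (by rw [h1, opp_opp])

theorem rootReflection_opp_left (h : a ≠ opp b) : rootReflection a b (opp a) = opp b := by
  rw [rootReflection, Equiv.Perm.mul_apply, Equiv.swap_apply_left,
    Equiv.swap_apply_of_ne_of_ne (fun h1 => h h1.symm) (opp_ne b)]

theorem rootReflection_opp_right (h : a ≠ opp b) : rootReflection a b (opp b) = opp a := by
  rw [rootReflection, Equiv.Perm.mul_apply, Equiv.swap_apply_right,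
    Equiv.swap_apply_of_ne_of_ne (opp_ne a)]
  intro h1
  exact h (by rw [← h1, opp_opp])

theorem rootReflection_of_ne {x : Fin n × ℤˣ} (h1 : x ≠ a) (h2 : x ≠ b) (h3 : x ≠ opp a)
    (h4 : x ≠ opp b) : rootReflection a b x = x := by
  rw [rootReflection, Equiv.Perm.mul_apply, Equiv.swap_apply_of_ne_of_ne h3 h4,
    Equiv.swap_apply_of_ne_of_ne h1 h2]

theorem rootReflection_opp_opp (h : a ≠ opp b) : rootReflection (opp b) (opp a) = rootReflection a b := by
  rw [rootReflection, rootReflection, opp_opp, opp_opp, Equiv.swap_comm b a,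
    Equiv.swap_comm (opp b), Equiv.mul_swap_eq_swap_mul, Equiv.swap_apply_of_ne_of_ne,
    Equiv.swap_apply_of_ne_of_ne]
  · intro h1
    exact h (by rw [h1, opp_opp])
  · exact (opp_ne b).symm
  · exact (opp_ne a).symm
  · exact h

theorem rootReflection_apply_cases (h : a ≠ opp b) (x : Fin n × ℤˣ) :
    (x = a ∧ rootReflection a b x = b) ∨ (x = b ∧ rootReflection a b x = a) ∨
    (x = opp a ∧ rootReflection a b x = opp b) ∨ (x = opp b ∧ rootReflection a b x = opp a) ∨
    rootReflection a b x = x := by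
  by_cases h1 : x = a
  · subst h1; exact Or.inl ⟨rfl, rootReflection_left h⟩
  by_cases h2 : x = b
  · subst h2; exact Or.inr (Or.inl ⟨rfl, rootReflection_right h⟩)
  by_cases h3 : x = opp a
  · subst h3; exact Or.inr (Or.inr (Or.inl ⟨rfl, rootReflection_opp_left h⟩))
  by_cases h4 : x = opp b
  · subst h4; exact Or.inr (Or.inr (Or.inr (Or.inl ⟨rfl, rootReflection_opp_right h⟩)))
  exact Or.inr (Or.inr (Or.inr (Or.inr (rootReflection_of_ne h1 h2 h3 h4))))

theorem rootReflection_opp (h : a ≠ opp b) (x : Fin n × ℤˣ) :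
    rootReflection a b (opp x) = opp (rootReflection a b x) := by
  by_cases h1 : x = a
  · subst h1; rw [rootReflection_left h, rootReflection_opp_left h]
  by_cases h2 : x = b
  · subst h2; rw [rootReflection_right h, rootReflection_opp_right h]
  by_cases h3 : x = opp a
  · subst h3; rw [opp_opp, rootReflection_left h, rootReflection_opp_left h, opp_opp]
  by_cases h4 : x = opp b
  · subst h4; rw [opp_opp, rootReflection_right h, rootReflection_opp_right h, opp_opp]
  rw [rootReflection_of_ne h1 h2 h3 h4, rootReflection_of_ne]
  · intro h5; exact h3 (by rw [← h5, opp_opp])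
  · intro h5; exact h4 (by rw [← h5, opp_opp])
  · exact fun h5 => h1 (opp_injective h5)
  · exact fun h5 => h2 (opp_injective h5)

theorem rootReflection_mul_self (h : a ≠ opp b) : rootReflection a b * rootReflection a b = 1 := by
  ext1 x
  rw [Equiv.Perm.mul_apply, Equiv.Perm.one_apply]
  rcases rootReflection_apply_cases h x with ⟨rfl, h1⟩ | ⟨rfl, h1⟩ | ⟨rfl, h1⟩ | ⟨rfl, h1⟩ | h1
  · rw [h1, rootReflection_right h]
  · rw [h1, rootReflection_left h]
  · rw [h1, rootReflection_opp_right h]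
  · rw [h1, rootReflection_opp_left h]
  · rw [h1, h1]

/-- A reflection in a simple root changes the sign of no other positive root. -/
theorem rootReflection_eq_of_height_lt (h : a ≠ opp b)
    (hab : height a = height b + 1) {x y : Fin n × ℤˣ}
    (hxy : y ≠ opp x) (h1 : height y < height x)
    (h2 : height (rootReflection a b x) < height (rootReflection a b y)) :
    rootReflection a b = rootReflection x y := by
  have ha := height_opp a
  have hb := height_opp b
  -- Comparing integer heights leaves only the pairs (a, b) and (`opp b`, `opp a`), which represent
  -- the same root.
  rcases rootReflection_apply_cases h x with
    ⟨rfl, hx⟩ | ⟨rfl, hx⟩ | ⟨rfl, hx⟩ | ⟨rfl, hx⟩ | hx <;>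
  rcases rootReflection_apply_cases h y with
    ⟨rfl, hy⟩ | ⟨rfl, hy⟩ | ⟨rfl, hy⟩ | ⟨rfl, hy⟩ | hy <;>
  first
  | rfl
  | exact (rootReflection_opp_opp h).symm
  | exact absurd h1 (lt_irrefl _)
  | exact absurd rfl hxy
  | exact absurd (opp_opp _).symm hxy
  | (exfalso; simp only [hx, hy] at h2; omega)

end RootReflection

theorem mul_rootReflection {w : Equiv.Perm (Fin n × ℤˣ)} (hw : ∀ x, w (opp x) = opp (w x))
    (a b : Fin n × ℤˣ) : w * rootReflection a b = rootReflection (w a) (w b) * w := by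
  rw [rootReflection, rootReflection, ← mul_assoc, Equiv.mul_swap_eq_swap_mul w, mul_assoc,
    Equiv.mul_swap_eq_swap_mul w, hw, hw, mul_assoc]

theorem sGen_eq {k : ℕ} (hk : k + 1 < n) :
    sGen n k = rootReflection (⟨k, by omega⟩, 1) (⟨k + 1, hk⟩, 1) := by
  have hne : (⟨k, by omega⟩ : Fin n) ≠ ⟨k + 1, hk⟩ := by simp
  rw [sGen, dif_pos hk]
  ext1 ⟨i, ε⟩
  rw [Equiv.prodCongr_apply, Prod.map_apply, Equiv.refl_apply]
  rw [rootReflection, Equiv.Perm.mul_apply]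
  rcases Int.units_eq_one_or ε with rfl | rfl <;> by_cases h1 : i = ⟨k, by omega⟩
  · subst h1; simp [opp, Equiv.swap_apply_def]
  · by_cases h2 : i = ⟨k + 1, hk⟩
    · subst h2; simp [opp, Equiv.swap_apply_def]
    · simp [opp, Equiv.swap_apply_def, h1, h2]
  · subst h1; simp [opp, Equiv.swap_apply_def]
  · by_cases h2 : i = ⟨k + 1, hk⟩
    · subst h2; simp [opp, Equiv.swap_apply_def]
    · simp [opp, Equiv.swap_apply_def, h1, h2]

theorem tGen_eq (hn : 2 ≤ n) : tGen n = Equiv.swap (⟨n - 1, by omega⟩, 1) (⟨n - 1, by omega⟩, -1) := by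
  rw [tGen, dif_pos (by omega)]

theorem tGen_apply (hn : 2 ≤ n) (a : Fin n × ℤˣ) :
    tGen n a = if a.1 = ⟨n - 1, by omega⟩ then opp a else a := by
  rw [tGen_eq hn]
  obtain ⟨i, ε⟩ := a
  by_cases h : i = ⟨n - 1, by omega⟩
  · subst h
    rcases Int.units_eq_one_or ε with rfl | rfl <;> simp [opp]
  · rw [if_neg h, Equiv.swap_apply_of_ne_of_ne] <;>
    exact fun h' => h (congrArg Prod.fst h')

theorem tGen_opp (hn : 2 ≤ n) (a : Fin n × ℤˣ) : tGen n (opp a) = opp (tGen n a) := by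
  rw [tGen_apply hn, tGen_apply hn]
  simp only [show (opp a).1 = a.1 from rfl]
  split_ifs <;> rfl

theorem tGen_mul_self (hn : 2 ≤ n) : tGen n * tGen n = 1 := by
  rw [tGen_eq hn, Equiv.swap_mul_self]

theorem gen_eq (hn : 2 ≤ n) : tGen n * sGen n (n - 2) * tGen n =
    rootReflection (⟨n - 2, by omega⟩, 1) (⟨n - 1, by omega⟩, -1) := by
  have hidx : (⟨n - 2 + 1, by omega⟩ : Fin n) = ⟨n - 1, by omega⟩ := Fin.ext (by simp; omega)
  rw [sGen_eq (by omega), mul_rootReflection (tGen_opp hn), mul_assoc, tGen_mul_self hn, mul_one,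
    tGen_apply hn, tGen_apply hn, hidx, if_neg, if_pos rfl]
  · rfl
  · simp; omega

/-- The pair of indices whose reflection is the generator of a node. -/
theorem exists_simpleReflection_eq (hn : 2 ≤ n) (j : Node n) : ∃ a b : Fin n × ℤˣ,
    a ≠ opp b ∧ height a = height b + 1 ∧ simpleReflection j = rootReflection a b := by
  cases j with
  | sub i =>
    have hi := i.2
    refine ⟨_, _, ?_, ?_, sGen_eq (by omega)⟩
    · simp [opp]
    · simp [height]; ring
  | gen =>
    refine ⟨_, _, ?_, ?_, gen_eq hn⟩
    · simp [opp]; omega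
    · simp [height]; omega
  | gen' =>
    refine ⟨_, _, ?_, ?_, sGen_eq (by omega)⟩
    · simp [opp]
    · simp [height]; ring

theorem simpleReflection_opp (hn : 2 ≤ n) (j : Node n) (x : Fin n × ℤˣ) :
    simpleReflection j (opp x) = opp (simpleReflection j x) := by
  obtain ⟨a, b, h, -, hj⟩ := exists_simpleReflection_eq hn j
  rw [hj, rootReflection_opp h]

theorem simpleReflection_mul_self (hn : 2 ≤ n) (j : Node n) :
    simpleReflection j * simpleReflection j = 1 := by
  obtain ⟨a, b, h, -, hj⟩ := exists_simpleReflection_eq hn j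
  rw [hj, rootReflection_mul_self h]

/-- The element of the Weyl group given by a word in the generators. -/
def wordProd (l : List (Node n)) : Equiv.Perm (Fin n × ℤˣ) := (l.map simpleReflection).prod

theorem wordProd_cons (j : Node n) (l : List (Node n)) :
    wordProd (j :: l) = simpleReflection j * wordProd l := by
  simp [wordProd]

theorem wordProd_append (l l' : List (Node n)) :
    wordProd (l ++ l') = wordProd l * wordProd l' := by
  simp [wordProd]

theorem wordProd_mem (l : List (Node n)) : wordProd l ∈ weylGroup n := by
  refine list_prod_mem fun x hx => ?_
  obtain ⟨j, -, rfl⟩ := List.mem_map.1 hx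
  exact Subgroup.subset_closure ⟨j, rfl⟩

theorem exists_wordProd_eq (hn : 2 ≤ n) {w : Equiv.Perm (Fin n × ℤˣ)} (hw : w ∈ weylGroup n) :
    ∃ l, wordProd l = w := by
  induction hw using Subgroup.closure_induction with
  | mem x hx =>
    obtain ⟨j, rfl⟩ := hx
    exact ⟨[j], by simp [wordProd]⟩
  | one => exact ⟨[], rfl⟩
  | mul x y _ _ hx hy =>
    obtain ⟨l, rfl⟩ := hx
    obtain ⟨l', rfl⟩ := hy
    exact ⟨l ++ l', wordProd_append l l'⟩
  | inv x _ hx =>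
    obtain ⟨l, rfl⟩ := hx
    refine ⟨l.reverse, ?_⟩
    induction l with
    | nil => simp [wordProd]
    | cons j l ih =>
      rw [List.reverse_cons, wordProd_append, ih (wordProd_mem l), wordProd_cons j l, mul_inv_rev,
        wordProd_cons, wordProd, wordProd, List.map_nil, List.prod_nil, mul_one,
        ← eq_inv_of_mul_eq_one_left (simpleReflection_mul_self hn j)]

theorem wordProd_opp (hn : 2 ≤ n) (l : List (Node n)) (x : Fin n × ℤˣ) :
    wordProd l (opp x) = opp (wordProd l x) := by
  induction l with
  | nil => rfl
  | cons j l ih => rw [wordProd_cons, Equiv.Perm.mul_apply, ih, simpleReflection_opp hn]; rfl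

/-- The deletion property. -/
theorem exists_shorter_word (hn : 2 ≤ n) {a b : Fin n × ℤˣ} (h : a ≠ opp b)
    (hab : height b < height a) (l : List (Node n))
    (hl : height (wordProd l a) < height (wordProd l b)) :
    ∃ l' : List (Node n), l'.length < l.length ∧ wordProd l' = wordProd l * rootReflection a b := by
  induction l with
  | nil => exact absurd hl (not_lt.2 hab.le)
  | cons j l ih =>
    rw [wordProd_cons] at hl ⊢
    -- Locate the letter that turns the root negative. If it is j, then `l` takes the root of (a, b)
    -- to the simple root of j, so s_j l = l r for the reflection r in (a, b), and the letter j is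
    -- deleted.
    rcases lt_trichotomy (height (wordProd l a)) (height (wordProd l b)) with h1 | h1 | h1
    · obtain ⟨l', hlen, hl'⟩ := ih h1
      refine ⟨j :: l', by simpa using hlen, ?_⟩
      rw [wordProd_cons, hl', mul_assoc]
    · refine absurd h1 (height_ne ?_ ?_)
      · intro h2
        rw [(wordProd l).injective h2] at hab
        exact lt_irrefl _ hab
      · rw [← wordProd_opp hn]
        exact fun h2 => h ((wordProd l).injective h2)
    · obtain ⟨c, d, hcd, hcd1, hj⟩ := exists_simpleReflection_eq hn j
      refine ⟨l, by simp, ?_⟩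
      rw [hj] at hl ⊢
      have h2 : wordProd l b ≠ opp (wordProd l a) := by
        rw [← wordProd_opp hn]
        intro h2
        exact h (by rw [(wordProd l).injective h2, opp_opp])
      rw [rootReflection_eq_of_height_lt hcd hcd1 h2 h1 hl, ← mul_rootReflection (wordProd_opp hn l),
        mul_assoc, rootReflection_mul_self h, mul_one]

theorem length_wordProd_le (l : List (Node n)) : length (wordProd l) ≤ l.length :=
  Nat.sInf_le ⟨l, rfl, rfl⟩

theorem exists_reduced_word (hn : 2 ≤ n) {w : Equiv.Perm (Fin n × ℤˣ)} (hw : w ∈ weylGroup n) :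
    ∃ l, wordProd l = w ∧ l.length = length w := by
  obtain ⟨l, hl⟩ := exists_wordProd_eq hn hw
  -- The infimum is attained because w has some word; on an empty set `sInf` would be the default 0.
  obtain ⟨l', h1, h2⟩ := Nat.sInf_mem (s := {k : ℕ | ∃ l : List (Node n), l.length = k ∧
    (l.map simpleReflection).prod = w}) ⟨_, l, rfl, hl⟩
  exact ⟨l', h2, h1⟩

/-- The longest element maps the simple roots to negative roots. -/
theorem IsLongest.height_lt (hn : 2 ≤ n) {w : Equiv.Perm (Fin n × ℤˣ)} (hw : IsLongest w)
    {j : Node n} {a b : Fin n × ℤˣ} (h : a ≠ opp b) (hab : height a = height b + 1)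
    (hj : simpleReflection j = rootReflection a b) : height (w a) < height (w b) := by
  by_contra hle
  have hopp : ∀ x, w (opp x) = opp (w x) := by
    obtain ⟨l, rfl⟩ := exists_wordProd_eq hn hw.1
    exact wordProd_opp hn l
  have hne : height (w a) ≠ height (w b) := by
    refine height_ne ?_ ?_
    · intro h2
      rw [w.injective h2] at hab
      omega
    · rw [← hopp]
      exact fun h2 => h (w.injective h2)
  -- If w keeps the simple root positive, w s_j makes it negative, so a reduced word of w s_j can be
  -- shortened to a word for w, against the maximality of w.
  have hmem : w * simpleReflection j ∈ weylGroup n :=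
    mul_mem hw.1 (Subgroup.subset_closure ⟨j, rfl⟩)
  obtain ⟨l, hl, hlen⟩ := exists_reduced_word hn hmem
  have h1 : height (wordProd l a) < height (wordProd l b) := by
    rw [hl, hj, Equiv.Perm.mul_apply, Equiv.Perm.mul_apply, rootReflection_left h,
      rootReflection_right h]
    omega
  obtain ⟨l', hlt, hl'⟩ := exists_shorter_word hn h (by omega) l h1
  rw [hl, hj, mul_assoc, rootReflection_mul_self h, mul_one] at hl'
  have h2 := length_wordProd_le l'
  rw [hl'] at h2
  have h3 := hw.2 _ hmem
  omega

/-- The product of the signs of a signed permutation. -/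
def signProd (w : Equiv.Perm (Fin n × ℤˣ)) : ℤˣ := ∏ i, (w (i, 1)).2

theorem bijective_fst {w : Equiv.Perm (Fin n × ℤˣ)} (hw : ∀ x, w (opp x) = opp (w x)) :
    Function.Bijective fun i : Fin n => (w (i, 1)).1 := by
  rw [← Finite.injective_iff_bijective]
  intro i j hij
  rcases eq_or_eq_opp hij with h | h
  · exact congrArg Prod.fst (w.injective h)
  · rw [← hw] at h
    exact congrArg Prod.fst (w.injective h)

theorem signProd_tGen_mul (hn : 2 ≤ n) {w : Equiv.Perm (Fin n × ℤˣ)}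
    (hw : ∀ x, w (opp x) = opp (w x)) : signProd (tGen n * w) = -signProd w := by
  have h : ∀ i : Fin n, ((tGen n * w) (i, 1)).2 =
      (if (w (i, 1)).1 = ⟨n - 1, by omega⟩ then -1 else 1) * (w (i, 1)).2 := by
    intro i
    rw [Equiv.Perm.mul_apply, tGen_apply hn]
    split_ifs <;> simp [opp]
  rw [signProd, signProd, Finset.prod_congr rfl fun i _ => h i, Finset.prod_mul_distrib,
    (bijective_fst hw).prod_comp fun k => if k = ⟨n - 1, by omega⟩ then (-1 : ℤˣ) else 1,
    Finset.prod_ite_eq' Finset.univ, if_pos (Finset.mem_univ _), neg_one_mul]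

theorem signProd_sGen_mul (k : ℕ) (w : Equiv.Perm (Fin n × ℤˣ)) :
    signProd (sGen n k * w) = signProd w := by
  refine Finset.prod_congr rfl fun i _ => ?_
  rw [Equiv.Perm.mul_apply, sGen]
  split_ifs <;> rfl

theorem sGen_opp (k : ℕ) (x : Fin n × ℤˣ) : sGen n k (opp x) = opp (sGen n k x) := by
  rw [sGen]
  split_ifs <;> rfl

/-- The s_k change no sign and t changes exactly one, so u = t s_{n-1} t changes the product twice.
-/
theorem signProd_wordProd (hn : 2 ≤ n) (l : List (Node n)) : signProd (wordProd l) = 1 := by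
  induction l with
  | nil => simp [signProd, wordProd]
  | cons j l ih =>
    rw [wordProd_cons]
    cases j with
    | sub i => rw [simpleReflection, signProd_sGen_mul, ih]
    | gen' => rw [simpleReflection, signProd_sGen_mul, ih]
    | gen =>
      have h1 : ∀ x, (sGen n (n - 2) * (tGen n * wordProd l)) (opp x) =
          opp ((sGen n (n - 2) * (tGen n * wordProd l)) x) := fun x => by
        simp only [Equiv.Perm.mul_apply, wordProd_opp hn, tGen_opp hn, sGen_opp]
      rw [simpleReflection, mul_assoc, mul_assoc, signProd_tGen_mul hn h1, signProd_sGen_mul,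
        signProd_tGen_mul hn (wordProd_opp hn l), ih, neg_neg]

theorem IsLongest.height_apply (hn : 2 ≤ n) {w : Equiv.Perm (Fin n × ℤˣ)} (hw : IsLongest w)
    {i : Fin n} (hi : (i : ℕ) + 1 < n) : height (w (i, 1)) = -((n : ℤ) - 1 - i) := by
  have hopp : ∀ x, w (opp x) = opp (w x) := by
    obtain ⟨l, rfl⟩ := exists_wordProd_eq hn hw.1
    exact wordProd_opp hn l
  have hstep : ∀ k (hk : k + 1 < n),
      height (w (⟨k, by omega⟩, 1)) < height (w (⟨k + 1, hk⟩, 1)) := by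
    intro k hk
    have h1 : ((⟨k, by omega⟩, 1) : Fin n × ℤˣ) ≠ opp (⟨k + 1, hk⟩, 1) := by simp [opp]
    have h2 : height ((⟨k, by omega⟩, 1) : Fin n × ℤˣ) = height ((⟨k + 1, hk⟩, 1) : Fin n × ℤˣ) + 1 := by
      simp [height]; ring
    by_cases hk2 : k < n - 2
    · exact hw.height_lt hn (j := .sub ⟨k, hk2⟩) h1 h2 (sGen_eq hk)
    · obtain rfl : k = n - 2 := by omega
      exact hw.height_lt hn (j := .gen') h1 h2 (sGen_eq hk)
  -- This is the simple root of u. With that of s_{n-1} it bounds the height of w(n-1) by both signs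
  -- of the height of w(n), so it is negative.
  have hlast : height (w (⟨n - 2, by omega⟩, 1)) < -height (w (⟨n - 2 + 1, by omega⟩, 1)) := by
    rw [← height_opp, ← hopp]
    have hidx : (⟨n - 2 + 1, by omega⟩ : Fin n) = ⟨n - 1, by omega⟩ := Fin.ext (by simp; omega)
    rw [hidx]
    refine hw.height_lt hn (j := .gen) ?_ ?_ (gen_eq hn)
    · simp [opp]; omega
    · rw [height_opp]; simp [height]; omega
  have hneg : height (w (⟨n - 2, by omega⟩, 1)) < 0 := by
    have := hstep (n - 2) (by omega)
    omega
  have hlow : ∀ a : Fin n × ℤˣ, -((n : ℤ) - 1) ≤ height a := by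
    intro a
    have ha := a.1.2
    unfold height
    rcases Int.units_eq_one_or a.2 with h | h <;> rw [h] <;> push_cast <;> omega
  -- The heights of w(1), …, w(n-1) are n - 1 strictly increasing integers between -(n-1) and -1,
  -- hence determined; `h1` and `h2` squeeze them from below and above.
  have h1 : ∀ k (hk : k < n), -((n : ℤ) - 1) + k ≤ height (w (⟨k, hk⟩, 1)) := by
    intro k
    induction k with
    | zero => intro hk; simpa using hlow _
    | succ k ih =>
      intro hk
      have := ih (by omega)
      have := hstep k hk
      push_cast
      omega
  have h2 : ∀ m (hm : m + 2 ≤ n), height (w (⟨n - 2 - m, by omega⟩, 1)) ≤ -(1 : ℤ) - m := by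
    intro m
    induction m with
    | zero => intro hm; simp only [Nat.sub_zero]; push_cast; omega
    | succ m ih =>
      intro hm
      have h3 := ih (by omega)
      have h4 := hstep (n - 2 - (m + 1)) (by omega)
      have hidx : (⟨n - 2 - (m + 1) + 1, by omega⟩ : Fin n) = ⟨n - 2 - m, by omega⟩ :=
        Fin.ext (by simp; omega)
      rw [hidx] at h4
      push_cast
      omega
  have h3 := h1 i i.2
  have h4 := h2 (n - 2 - i) (by omega)
  have hidx : (⟨n - 2 - (n - 2 - i), by omega⟩ : Fin n) = i := Fin.ext (by simp; omega)
  rw [hidx] at h4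
  rw [Fin.eta] at h3
  omega

theorem eq_opp_of_height {a : Fin n × ℤˣ} {i : Fin n} (hi : (i : ℕ) + 1 < n)
    (h : height a = -((n : ℤ) - 1 - i)) : a = (i, -1) := by
  have ha := a.1.2
  unfold height at h
  rcases Int.units_eq_one_or a.2 with h1 | h1 <;> rw [h1] at h <;> push_cast at h
  · omega
  · exact Prod.ext (Fin.ext (show (a.1 : ℕ) = i by omega)) h1

/-- The longest element maps `i` to `-i` for `i ≤ n - 1`. -/
theorem IsLongest.apply_of_lt (hn : 2 ≤ n) {w : Equiv.Perm (Fin n × ℤˣ)} (hw : IsLongest w)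
    {i : Fin n} (hi : (i : ℕ) + 1 < n) : w (i, 1) = (i, -1) :=
  eq_opp_of_height hi (hw.height_apply hn hi)

/-- If `n` is even, then the longest element is `i ↦ -i`. -/
theorem IsLongest.apply_of_even (hn : 2 ≤ n) (heven : Even n) {w : Equiv.Perm (Fin n × ℤˣ)}
    (hw : IsLongest w) (a : Fin n × ℤˣ) : w a = opp a := by
  obtain ⟨l, rfl⟩ := exists_wordProd_eq hn hw.1
  have hopp := wordProd_opp hn l
  have hlt : ∀ i : Fin n, i ≠ ⟨n - 1, by omega⟩ → wordProd l (i, 1) = (i, -1) := by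
    intro i hi
    have : (i : ℕ) ≠ n - 1 := fun h => hi (Fin.ext h)
    exact hw.apply_of_lt hn (by omega)
  have hfst : (wordProd l (⟨n - 1, by omega⟩, 1)).1 = ⟨n - 1, by omega⟩ := by
    by_contra hne
    have h1 := hlt _ hne
    exact hne ((bijective_fst hopp).1 (congrArg Prod.fst h1 :))
  -- The other n - 1 signs are -1 and n - 1 is odd, so a total product of 1 forces the last sign.
  have hsnd : (wordProd l (⟨n - 1, by omega⟩, 1)).2 = -1 := by
    have h1 := signProd_wordProd hn l
    rw [signProd, ← Finset.mul_prod_erase _ _ (Finset.mem_univ (⟨n - 1, by omega⟩ : Fin n)),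
      Finset.prod_congr rfl fun i hi => congrArg Prod.snd (hlt i (Finset.ne_of_mem_erase hi)),
      Finset.prod_const, Finset.card_erase_of_mem (Finset.mem_univ _), Finset.card_univ,
      Fintype.card_fin, Odd.neg_one_pow (Nat.Even.sub_odd (by omega) heven odd_one)] at h1
    simpa using congrArg Neg.neg h1
  have hpos : ∀ i : Fin n, wordProd l (i, 1) = (i, -1) := by
    intro i
    by_cases hi : i = ⟨n - 1, by omega⟩
    · subst hi; exact Prod.ext hfst hsnd
    · exact hlt i hi
  obtain ⟨i, ε⟩ := a
  rcases Int.units_eq_one_or ε with rfl | rfl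
  · exact hpos i
  · exact (hopp (i, 1)).trans (congrArg opp (hpos i))

end Weyl

end Oriflamme

namespace Oriflamme

open Module

/-! ### Opposite flags and intersections of generators -/

section Opposition

open QuadraticMap

variable {F V : Type*} [Field F] [AddCommGroup V] [Module F V] {Q : QuadraticForm F V} {n : ℕ}
  {e : Fin n × ℤˣ → V} {J : Set (Node n)} {w₀ : Equiv.Perm (Fin n × ℤˣ)} {x y : Flag Q e J}

theorem Opposite.exists_isometry (h : Opposite w₀ x y) : ∃ g : V ≃ₗ[F] V, (∀ z, Q (g z) = Q z) ∧
    ∀ j hj, x.elt j hj = (frameSpace e j).map (g : V →ₗ[F] V) ∧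
      y.elt j hj = (frameSpace (e ∘ w₀) j).map (g : V →ₗ[F] V) := by
  obtain ⟨-, c, d, hc, hd, g, hg, hgc, hgd⟩ := h
  exact ⟨g, hg.1, fun j hj => ⟨by rw [← hc, hgc], by rw [← hd, hgd]⟩⟩

/-- The points of opposite flags are not collinear. -/
theorem Opposite.exists_polar_ne_zero (hn : 4 ≤ n) (he : IsPolarFrame Q e) (hw₀ : IsLongest w₀)
    (h : Opposite w₀ x y) (h1 : pointNode n hn ∈ J) :
    ∃ a ∈ x.elt _ h1, ∃ b ∈ y.elt _ h1, polar Q a b ≠ 0 := by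
  obtain ⟨g, hg, hxy⟩ := h.exists_isometry
  let i : Fin n := ⟨0, by omega⟩
  have hmem : ∀ f : Fin n × ℤˣ → V, f (i, 1) ∈ frameSpace (F := F) f (pointNode n hn) := fun f =>
    Submodule.subset_span ⟨(i, 1), ⟨le_rfl, rfl⟩, rfl⟩
  refine ⟨g (e (i, 1)), ?_, g ((e ∘ w₀) (i, 1)), ?_, ?_⟩
  · rw [(hxy _ h1).1]
    exact Submodule.mem_map_of_mem (hmem e)
  · rw [(hxy _ h1).2]
    exact Submodule.mem_map_of_mem (hmem (e ∘ w₀))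
  · have hi : (i : ℕ) + 1 < n := by simp only [i]; omega
    rw [polar, ← map_add, hg, hg, hg, Function.comp_apply, hw₀.apply_of_lt (by omega) hi]
    exact fun h0 => (he.2 _ _).1 h0 rfl

/-- `S` contains at most one of i and -i for each i, as the index sets of both standard generators
do. -/
theorem disjoint_image_of_opp {w : Equiv.Perm (Fin n × ℤˣ)} (hw : ∀ a, w a = opp a)
    {S : Set (Fin n × ℤˣ)} {f : Fin n → ℤˣ} (hS : ∀ a ∈ S, a.2 = f a.1) : Disjoint S (w '' S) := by
  rw [Set.disjoint_left]
  rintro _ ha ⟨a, ha', rfl⟩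
  rw [hw] at ha
  refine opp_ne a (Prod.ext rfl ?_)
  rw [hS _ ha, hS _ ha']
  rfl

/-- If `n` is even, then the generators of opposite flags are disjoint. -/
theorem Opposite.disjoint (hn : 2 ≤ n) (heven : Even n) (he : IsPolarFrame Q e)
    (hw₀ : IsLongest w₀) (h : Opposite w₀ x y) {j : Node n} (hjg : j = .gen ∨ j = .gen')
    (hj : j ∈ J) : Disjoint (x.elt j hj) (y.elt j hj) := by
  obtain ⟨g, -, hxy⟩ := h.exists_isometry
  rw [(hxy j hj).1, (hxy j hj).2]
  have hdis : Disjoint (frameSpace (F := F) e j) (frameSpace (e ∘ w₀) j) := by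
    have hopp := hw₀.apply_of_even hn heven
    rcases hjg with rfl | rfl
    · rw [frameSpace, frameSpace, Set.image_comp]
      exact he.linearIndependent.disjoint_span_image
        (disjoint_image_of_opp hopp (f := fun _ => 1) fun a ha => ha)
    · rw [frameSpace, frameSpace, Set.image_comp]
      exact he.linearIndependent.disjoint_span_image
        (disjoint_image_of_opp hopp (f := fun i => if i.val + 1 = n then -1 else 1)
          fun a ha => ha)
  rw [disjoint_iff] at hdis ⊢
  rw [← Submodule.map_inf _ g.injective, hdis, Submodule.map_bot]

theorem HasType.isGenerator {j : Node n} (hjg : j = .gen ∨ j = .gen') {U : Submodule F V}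
    (h : HasType Q e j U) : IsGenerator n Q U := by
  rcases hjg with rfl | rfl
  · exact h.1
  · exact h.1

/-- The parity of the intersection of generators of different classes. -/
theorem odd_finrank_inf [FiniteDimensional F V] (hQ : IsHyperbolic n Q) (he : IsPolarFrame Q e)
    {j k : Node n} (hjk : j = .gen ∧ k = .gen' ∨ j = .gen' ∧ k = .gen) {U M : Submodule F V}
    (hU : HasType Q e j U) (hM : HasType Q e k M) :
    Odd (n + finrank F (U ⊓ M : Submodule F V)) := by
  rcases hjk with ⟨rfl, rfl⟩ | ⟨rfl, rfl⟩
  all_goals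
    have h := even_finrank_inf_add hQ hU.1 hM.1 he.isGenerator
    have h1 := hU.2
    have h2 := hM.2
    rw [Nat.even_iff] at h
    rw [Nat.ModEq] at h1 h2
    rw [Nat.odd_iff]
    omega

/-- An inclusion would be an equality of 4-spaces, while generators of different classes meet in odd
dimension. -/
theorem incident_iff [FiniteDimensional F V] (hn : n = 4) (hQ : IsHyperbolic n Q)
    (he : IsPolarFrame Q e)
    {j k : Node n} (hjk : j = .gen ∧ k = .gen' ∨ j = .gen' ∧ k = .gen) {U M : Submodule F V}
    (hU : HasType Q e j U) (hM : HasType Q e k M) :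
    Incident j k U M ↔ finrank F (U ⊓ M : Submodule F V) = 3 := by
  have hodd := odd_finrank_inf hQ he hjk hU hM
  have hUg := hU.isGenerator (hjk.imp And.left And.left)
  have hMg := hM.isGenerator (hjk.symm.imp And.right And.right)
  rw [Nat.odd_iff] at hodd
  constructor
  · rintro (h | h | ⟨-, h⟩)
    · rw [inf_eq_left.2 h, hUg.2] at hodd
      omega
    · rw [inf_eq_right.2 h, hMg.2] at hodd
      omega
    · omega
  · intro h
    exact Or.inr (Or.inr ⟨hjk, by omega⟩)

theorem finrank_inf_eq_one_of_not_incident [FiniteDimensional F V] (hn : n = 4)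
    (hQ : IsHyperbolic n Q) (he : IsPolarFrame Q e)
    {j k : Node n} (hjk : j = .gen ∧ k = .gen' ∨ j = .gen' ∧ k = .gen) {U M : Submodule F V}
    (hU : HasType Q e j U) (hM : HasType Q e k M) (h : ¬ Incident j k U M) :
    finrank F (U ⊓ M : Submodule F V) = 1 := by
  rw [incident_iff hn hQ he hjk hU hM] at h
  have hodd := odd_finrank_inf hQ he hjk hU hM
  have hUg := hU.isGenerator (hjk.imp And.left And.left)
  have hle : finrank F (U ⊓ M : Submodule F V) ≤ finrank F U := Submodule.finrank_mono inf_le_left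
  rw [Nat.odd_iff] at hodd
  rw [hUg.2] at hle
  omega

theorem finrank_inf_eq_zero [FiniteDimensional F V] {P M : Submodule F V}
    (hP : finrank F P = 1) (h : ¬ P ≤ M) : finrank F (P ⊓ M : Submodule F V) = 0 := by
  have hlt : P ⊓ M < P := lt_of_le_of_ne inf_le_left fun h' => h (inf_eq_left.1 h')
  have := Submodule.finrank_lt_finrank_of_lt hlt
  omega

end Opposition

end Oriflamme


/-! ### The three families -/

theorem mainTheorem10 {F V : Type*} [Field F] [Finite F] [AddCommGroup V] [Module F V]
    (n : ℕ) (hn : 4 ≤ n)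
    (Q : QuadraticForm F V) (hQ : Oriflamme.IsHyperbolic n Q)
    (e : Fin n × ℤˣ → V) (he : Oriflamme.IsPolarFrame Q e)
    (w₀ : Equiv.Perm (Fin n × ℤˣ)) (hw₀ : Oriflamme.IsLongest w₀)
    (J : Set (Oriflamme.Node n)) (hJ : Oriflamme.ConjType w₀ J J) :
    -- (i) flags whose point lies in a fixed generator
    (∀ (h1 : Oriflamme.pointNode n hn ∈ J) (M : Submodule F V), Oriflamme.IsGenerator n Q M →
      Oriflamme.IsEKR w₀ {x : Oriflamme.Flag Q e J | x.elt _ h1 ≤ M} ∧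
      Oriflamme.MeetsBound {x : Oriflamme.Flag Q e J | x.elt _ h1 ≤ M}) ∧
    -- (ii) flags whose subspace of type n (resp. n') passes through a fixed point, n even
    (Even n → ∀ j : Oriflamme.Node n, (j = .gen ∨ j = .gen') →
      ∀ (hj : j ∈ J) (P : Submodule F V), Oriflamme.IsPoint Q P →
      Oriflamme.IsEKR w₀ {x : Oriflamme.Flag Q e J | P ≤ x.elt j hj} ∧
      Oriflamme.MeetsBound {x : Oriflamme.Flag Q e J | P ≤ x.elt j hj}) ∧
    -- (iii) flags whose subspace of type n (resp. n') is incident with a fixed one of type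
    -- n' (resp. n), for n = 4
    (n = 4 → ∀ j k : Oriflamme.Node n, (j = .gen ∧ k = .gen' ∨ j = .gen' ∧ k = .gen) →
      ∀ (hj : j ∈ J) (M : Submodule F V), Oriflamme.HasType Q e k M →
      Oriflamme.IsEKR w₀ {x : Oriflamme.Flag Q e J | Oriflamme.Incident j k (x.elt j hj) M} ∧
      Oriflamme.MeetsBound
        {x : Oriflamme.Flag Q e J | Oriflamme.Incident j k (x.elt j hj) M}) := by
  have hfd : FiniteDimensional F V := hQ.finiteDimensional (by omega)
  have hn3 : 3 ≤ n := by omega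
  have hn2 : 2 ≤ n := by omega
  refine ⟨fun h1 M hM => ⟨?_, ?_⟩, fun heven j hjg hj P hP => ⟨?_, ?_⟩,
    fun hn4 j k hjk hj M hM => ⟨?_, ?_⟩⟩
  · intro x hx y hy hop
    obtain ⟨a, ha, b, hb, hab⟩ := hop.exists_polar_ne_zero hn he hw₀ h1
    exact hab (Oriflamme.polar_eq_zero_of_totallySingular hM.1 (hx ha) (hy hb))
  · have hd : ∀ x : Oriflamme.Flag Q e J, Module.finrank F (x.elt _ h1) = 1 := fun x =>
      (x.hasType _ h1).2
    refine Oriflamme.meetsBound_of_finrank_inf hn3 hQ he h1 hd hM.1 zero_lt_one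
      (fun x hx => ?_) (fun x hx => Oriflamme.finrank_inf_eq_zero (hd x) hx) ?_
    · rw [inf_eq_left.2 hx, hd]
    · rw [hM.2]
      ring
  · intro x hx y hy hop
    have hbot : P ≤ ⊥ := hop.disjoint hn2 heven he hw₀ hjg hj hx hy
    have hrank := hP.2
    rw [le_bot_iff.1 hbot, finrank_bot] at hrank
    exact zero_ne_one hrank
  · have hd : ∀ x : Oriflamme.Flag Q e J, Module.finrank F (x.elt j hj) = n := fun x =>
      ((x.hasType j hj).isGenerator hjg).2
    refine Oriflamme.meetsBound_of_finrank_inf hn3 hQ he hj hd hP.1 zero_lt_one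
      (fun x hx => ?_) (fun x hx => ?_) ?_
    · rw [inf_eq_right.2 hx, hP.2]
    · rw [inf_comm, Oriflamme.finrank_inf_eq_zero hP.2 hx]
    · rw [hP.2]
      ring
  · intro x hx y hy hop
    have hjg := hjk.imp And.left And.left
    have hdis := hop.disjoint hn2 (by rw [hn4]; decide) he hw₀ hjg hj
    have hx3 := (Oriflamme.incident_iff hn4 hQ he hjk (x.hasType j hj) hM).1 hx
    have hy3 := (Oriflamme.incident_iff hn4 hQ he hjk (y.hasType j hj) hM).1 hy
    have hMn := (hM.isGenerator (hjk.symm.imp And.right And.right)).2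
    -- Disjoint generators would give two disjoint 3-spaces in the 4-space M.
    have hsup := Submodule.finrank_sup_add_finrank_inf_eq (x.elt j hj ⊓ M) (y.elt j hj ⊓ M)
    rw [(hdis.mono (inf_le_left (b := M)) (inf_le_left (b := M))).eq_bot, finrank_bot] at hsup
    have hle := Submodule.finrank_mono
      (sup_le (inf_le_right (a := x.elt j hj)) (inf_le_right (a := y.elt j hj)) : _ ≤ M)
    omega
  · have hjg := hjk.imp And.left And.left
    have hMg := hM.isGenerator (hjk.symm.imp And.right And.right)
    have hd : ∀ x : Oriflamme.Flag Q e J, Module.finrank F (x.elt j hj) = n := fun x =>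
      ((x.hasType j hj).isGenerator hjg).2
    -- The identity required is q^4 - 1 = q^3 - q + (1 + q^3)(q - 1), times q^4 - 1.
    refine Oriflamme.meetsBound_of_finrank_inf hn3 hQ he hj hd hMg.1 (a := 3) (b := 1)
      (by omega) (fun x hx => ?_) (fun x hx => ?_) ?_
    · exact (Oriflamme.incident_iff hn4 hQ he hjk (x.hasType j hj) hM).1 hx
    · exact Oriflamme.finrank_inf_eq_one_of_not_incident hn4 hQ he hjk (x.hasType j hj) hM hx
    · rw [hMg.2, hn4]
      ring
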